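/- Let $g,m\ge 0$ be integers, let $0=a_1<b_1<a_2<b_2<\dots<b_g<a_{g+1}$ be real numbers, and put $I_j=(b_j,a_{j+1})$ and $I_{-j}=(-a_{j+1},-b_j)$ for $1\le j\le g$. Define the weights $$w_j(y)=\frac1\pi\sqrt{\frac{y-b_j}{a_{j+1}-y}}\quad(y\in I_j),\qquad w_{-j}(y)=\frac1\pi\sqrt{\frac{-b_j-y}{y+a_{j+1}}}\quad(y\in I_{-j}),\qquad 1\le j\le g,$$ each extended by $0$ outside its interval, and let $L^2_w(\bigcup_j I_j)=\bigoplus_{j=\pm1,\dots,\pm g}L^2_{w_j}(I_j)$, where $L^2_{w_j}(I_j)$ consists of the measurable $f$ with $\int_{I_j}|f|^2w_j\,dy<\infty$ (componentwise for matrix-valued functions). Let $\Omega_1,\dots,\Omega_g\in\mathbb C$ and let $$J_j=\sigma_1e^{-i\,\mathrm{sgn}(j)\,\Omega_{|j|}\sigma_3},\qquad \sigma_1=\begin{bmatrix}0&1\\1&0\end{bmatrix},\quad \sigma_3=\begin{bmatrix}1&0\\0&-1\end{bmatrix},\qquad j=\pm1,\dots,\pm g.$$ Let $\mathbf C\in\mathbb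 C^{m\times 2}$, let $\Gamma=\bigcup_j\overline{I_j}$, and let $\mathbf S:\mathbb C\setminus\Gamma\to\mathbb C^{m\times2}$ be analytic. Write $\mathbf S^\pm(y)=\lim_{\epsilon\downarrow0}\mathbf S(y\pm i\epsilon)$ where the limits exist, and let $\mathcal W$ denote division by $w_j$ on $I_j$: $(\mathcal W\mathbf F)_j=w_j^{-1}\,\mathbf F|_{I_j}$. Suppose that 1. for some $1<p<2$ and some norm $\|\cdot\|$ on $\mathbb C^{m\times2}$, $\displaystyle\sup_{\rho>0}\int_{-\infty}^\infty\|\mathbf S(y\pm i\rho)-\mathbf C\|^p\,dy<\infty$ for both signs (which forces $\mathbf S^\pm$ to exist a.e.); 2. $\mathbf S^+(y)=\mathbf S^-(y)J_j$ for a.e. $y\in I_j$, for each $j=\pm1,\dots,\pm g$; 3. $\mathbf U:=\mathcal W(\mathbf S^+-\mathbf S^-)\in L^2_w(\bigcup_jI_j)$. Then $\mathbf S$ is a solution, with density $\mathbf U=(\mathbf U_j)_j$, of the Riemann–Hilbert problem $\mathbf S^+=\mathbf S^-J_j$ on $I_j$, $\mathbf S(\infty)=\mathbf C$, in the following sense: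 $\mathbf U\in L^2_w(\bigcup_jI_j)$; the boundary values $\mathbf S^\pm$ exist a.e. on each $I_j$ and satisfy $\mathbf S^+=\mathbf S^-J_j$ a.e. there; and $$\mathbf S(z)=\mathbf C+\sum_{\substack{j=-g\\ j\ne0}}^{g}\mathcal C_{w_j}\mathbf U_j(z),\qquad \mathcal C_{w_j}\mathbf U_j(z)=\frac1{2\pi i}\int_{I_j}\frac{\mathbf U_j(y)}{y-z}\,w_j(y)\,dy,\qquad z\in\mathbb C\setminus\Gamma.$$ -/

import Mathlib

open MeasureTheory Filter Topology

noncomputable section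

namespace RHP

/-- The index set `{-g, …, -1, 1, …, g}`. -/
def idx (g : ℕ) : Finset ℤ := (Finset.Icc (-(g : ℤ)) (g : ℤ)).erase 0

/-- The open interval `I_j`: it is `(b_j, a_{j+1})` for `j > 0` and its reflection
`(-a_{|j|+1}, -b_{|j|})` for `j < 0`. -/
def cut (a b : ℕ → ℝ) (j : ℤ) : Set ℝ :=
  if 0 < j then Set.Ioo (b j.natAbs) (a (j.natAbs + 1))
  else Set.Ioo (-a (j.natAbs + 1)) (-b j.natAbs)

/-- The contour `Γ` in the complex plane: the union of all the cuts with their endpoints. -/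
def contour (g : ℕ) (a b : ℕ → ℝ) : Set ℂ :=
  ⋃ j ∈ idx g, (fun y : ℝ => (y : ℂ)) '' closure (cut a b j)

/-- The weight `w_j`, vanishing outside `I_j`. -/
def weight (a b : ℕ → ℝ) (j : ℤ) : ℝ → ℝ :=
  (cut a b j).indicator fun y =>
    if 0 < j then
      1 / Real.pi * Real.sqrt ((y - b j.natAbs) / (a (j.natAbs + 1) - y))
    else
      1 / Real.pi * Real.sqrt ((-b j.natAbs - y) / (y + a (j.natAbs + 1)))

/-- The Pauli matrix `σ₁`. -/
def pauli1 : Matrix (Fin 2) (Fin 2) ℂ := !![0, 1; 1, 0]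

/-- The Pauli matrix `σ₃`. -/
def pauli3 : Matrix (Fin 2) (Fin 2) ℂ := !![1, 0; 0, -1]

/-- The jump matrix `J_j = σ₁ exp(-i sgn(j) Ω_{|j|} σ₃)`, with arbitrary complex `Ω_{|j|}`. -/
def jumpMatrix (Ω : ℕ → ℂ) (j : ℤ) : Matrix (Fin 2) (Fin 2) ℂ :=
  pauli1 * NormedSpace.exp ((-(Complex.I * ((j.sign : ℤ) : ℂ) * Ω j.natAbs)) • pauli3)

/-- `A` is the boundary value of `S` at the real point `y` from above. -/
def HasPlusValue {m : ℕ} (S : ℂ → Matrix (Fin m) (Fin 2) ℂ) (y : ℝ)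
    (A : Matrix (Fin m) (Fin 2) ℂ) : Prop :=
  Tendsto (fun ε : ℝ => S ((y : ℂ) + (ε : ℂ) * Complex.I)) (𝓝[>] 0) (𝓝 A)

/-- `A` is the boundary value of `S` at the real point `y` from below. -/
def HasMinusValue {m : ℕ} (S : ℂ → Matrix (Fin m) (Fin 2) ℂ) (y : ℝ)
    (A : Matrix (Fin m) (Fin 2) ℂ) : Prop :=
  Tendsto (fun ε : ℝ => S ((y : ℂ) - (ε : ℂ) * Complex.I)) (𝓝[>] 0) (𝓝 A)

/-- The boundary value `S⁺(y)` (meaningful where the limit exists). -/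
def plusValue {m : ℕ} (S : ℂ → Matrix (Fin m) (Fin 2) ℂ) (y : ℝ) :
    Matrix (Fin m) (Fin 2) ℂ :=
  limUnder (𝓝[>] (0 : ℝ)) fun ε : ℝ => S ((y : ℂ) + (ε : ℂ) * Complex.I)

/-- The boundary value `S⁻(y)` (meaningful where the limit exists). -/
def minusValue {m : ℕ} (S : ℂ → Matrix (Fin m) (Fin 2) ℂ) (y : ℝ) :
    Matrix (Fin m) (Fin 2) ℂ :=
  limUnder (𝓝[>] (0 : ℝ)) fun ε : ℝ => S ((y : ℂ) - (ε : ℂ) * Complex.I)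

/-- Both boundary values of `S` exist almost everywhere on each `I_j`. -/
def HasBoundaryValues {m : ℕ} (g : ℕ) (a b : ℕ → ℝ)
    (S : ℂ → Matrix (Fin m) (Fin 2) ℂ) : Prop :=
  ∀ j ∈ idx g, ∀ᵐ y ∂(volume.restrict (cut a b j)),
    (∃ A, HasPlusValue S y A) ∧ (∃ B, HasMinusValue S y B)

/-- The jump condition `S⁺ = S⁻ J_j` almost everywhere on each `I_j`. -/
def JumpCondition {m : ℕ} (g : ℕ) (a b : ℕ → ℝ) (Ω : ℕ → ℂ)
    (S : ℂ → Matrix (Fin m) (Fin 2) ℂ) : Prop :=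
  ∀ j ∈ idx g, ∀ᵐ y ∂(volume.restrict (cut a b j)),
    plusValue S y = minusValue S y * jumpMatrix Ω j

/-- The operator `𝒲`: on `I_j`, division by the weight `w_j`. -/
def divWeight {m : ℕ} (a b : ℕ → ℝ) (D : ℝ → Matrix (Fin m) (Fin 2) ℂ) (j : ℤ) (y : ℝ) :
    Matrix (Fin m) (Fin 2) ℂ :=
  (((weight a b j y)⁻¹ : ℝ) : ℂ) • D y

/-- Membership in `L²_w(⋃ I_j)`, the direct sum of the spaces `L²_{w_j}(I_j)`,
entry by entry. -/
def MemWeightedL2 {m : ℕ} (g : ℕ) (a b : ℕ → ℝ)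
    (U : ℤ → ℝ → Matrix (Fin m) (Fin 2) ℂ) : Prop :=
  ∀ j ∈ idx g, ∀ (i : Fin m) (k : Fin 2),
    MemLp (fun y => U j y i k) 2
      ((volume.restrict (cut a b j)).withDensity fun y => ENNReal.ofReal (weight a b j y))

/-- The weighted Cauchy transform
`𝒞_{w_j} u (z) = (2πi)⁻¹ ∫_{I_j} u(y) / (y - z) w_j(y) dy`, entry by entry. -/
def cauchy {m : ℕ} (a b : ℕ → ℝ) (j : ℤ) (u : ℝ → Matrix (Fin m) (Fin 2) ℂ) (z : ℂ) :
    Matrix (Fin m) (Fin 2) ℂ :=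
  Matrix.of fun i k =>
    1 / (2 * (Real.pi : ℂ) * Complex.I) *
      ∫ y in cut a b j, u y i k / ((y : ℂ) - z) * ((weight a b j y : ℝ) : ℂ)

/-- `S` is a solution of the Riemann–Hilbert problem `S⁺ = S⁻ J_j` on `I_j`, `S(∞) = C`,
in the weighted-Cauchy-transform sense, with density `U`. -/
structure IsSolutionWith {m : ℕ} (g : ℕ) (a b : ℕ → ℝ) (Ω : ℕ → ℂ)
    (C : Matrix (Fin m) (Fin 2) ℂ) (S : ℂ → Matrix (Fin m) (Fin 2) ℂ)
    (U : ℤ → ℝ → Matrix (Fin m) (Fin 2) ℂ) : Prop where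
  memL2 : MemWeightedL2 g a b U
  repr : ∀ z : ℂ, z ∉ contour g a b → S z = C + ∑ j ∈ idx g, cauchy a b j (U j) z
  boundary : HasBoundaryValues g a b S
  jump : JumpCondition g a b Ω S

end RHP

end

/-!
Entry by entry, the theorem is a statement about a scalar function `F = S - C`, holomorphic off the
compact set `Γ` of the real line and in the Hardy class `H^p` of both half-planes: `F` has boundary
values almost everywhere, and it is the Cauchy integral of its jump.

*Boundary values* (`IsHardy.ae_exists_tendsto`). Averaging `F` over discs gives
`F = O(|Im z|^{-1/p})` (`IsHardy.exists_norm_le`). This is integrable along vertical segments since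
`p > 1`, so that a primitive `G` of `F` extends continuously to the real line
(`exists_primitive_continuousOn`). By Hölder's inequality the `L^p` bound also makes `G` of locally
bounded variation on the real line, hence differentiable almost everywhere there. Where `G` is
differentiable along the real line, the maximum principle upgrades this to differentiability from
within the half-plane (`isLittleO_upper_of_real`), and Cauchy's estimate then gives
`F(x + iε) → G'(x)` (`tendsto_vertical_of_hasDerivAt`).

*Cauchy representation* (`IsCutHardy.two_pi_I_mul_eq_integral`). Cauchy's theorem is applied to the
difference quotient `(F(ζ) - F(z)) / (ζ - z)` on the two halves of a large square, cut along the
lines `Im ζ = ±ε`. As `ε → 0` the cuts contribute the integral of the jump over `Γ`: the `L^p` bound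
gives uniform integrability, so almost everywhere convergence suffices
(`tendsto_integral_of_eLpNorm_le`), and the two boundary values agree off `Γ`. As the square grows,
the decay of `F` leaves only `-F(z)` times the winding number `2πi`.

Finally the closed cuts are pairwise disjoint and the weight is nonzero on each open cut, so the
integral over `Γ` is the sum of the weighted Cauchy transforms.
-/

/-! ### The Hardy class of the upper half-plane and its pointwise bound -/

/-- A holomorphic function on the open upper half-plane whose restrictions to horizontal lines are
bounded by `K` in `L^p`: the Hardy class `H^p`, with the bound recorded. -/
structure IsHardy (p : ℝ) (K : NNReal) (F : ℂ → ℂ) : Prop where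
  differentiableOn : DifferentiableOn ℂ F {z | 0 < z.im}
  eLpNorm_le : ∀ ρ : ℝ, 0 < ρ →
    eLpNorm (fun x : ℝ => F (x + ρ * Complex.I)) (ENNReal.ofReal p) volume ≤ K

theorem isOpen_upper : IsOpen {z : ℂ | 0 < z.im} :=
  isOpen_lt continuous_const Complex.continuous_im

namespace IsHardy

variable {p : ℝ} {K : NNReal} {F : ℂ → ℂ}

theorem continuous_line (hF : IsHardy p K F) {ρ : ℝ} (hρ : 0 < ρ) :
    Continuous fun x : ℝ => F (x + ρ * Complex.I) :=
  hF.differentiableOn.continuousOn.comp_continuous (by fun_prop) fun x => by simpa using hρ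

theorem setLIntegral_le (hF : IsHardy p K F) (hp : 1 < p) {ρ : ℝ} (hρ : 0 < ρ) (s : Set ℝ) :
    ∫⁻ x in s, ‖F (x + ρ * Complex.I)‖ₑ ≤ K * volume s ^ (1 - 1 / p) := by
  have h := eLpNorm_le_eLpNorm_mul_rpow_measure_univ (p := 1) (q := ENNReal.ofReal p)
    (μ := volume.restrict s) (by simpa using hp.le)
    ((hF.continuous_line hρ).aestronglyMeasurable)
  rw [eLpNorm_one_eq_lintegral_enorm] at h
  refine h.trans ?_
  rw [ENNReal.toReal_ofReal (by linarith), Measure.restrict_apply_univ]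
  simp only [ENNReal.toReal_one, div_one]
  gcongr
  exact (eLpNorm_mono_measure _ Measure.restrict_le_self).trans (hF.eLpNorm_le ρ hρ)

end IsHardy

/-- The sub-mean value property over circles. -/
theorem enorm_mul_two_pi_le_lintegral_circle {F : ℂ → ℂ} {c : ℂ} {r : ℝ} (hr : 0 < r)
    (hF : DifferentiableOn ℂ F (Metric.closedBall c r)) :
    ‖F c‖ₑ * ENNReal.ofReal (2 * Real.pi) ≤
      ∫⁻ θ in Set.Ioo (-Real.pi) Real.pi, ‖F (circleMap c r θ)‖ₑ := by
  have h1 : Real.circleAverage F c r = F c := by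
    apply DiffContOnCl.circleAverage
    rw [abs_of_pos hr]
    exact DifferentiableOn.diffContOnCl (by rwa [closure_ball c hr.ne'])
  rw [Real.circleAverage_eq_integral_add (-Real.pi),
    intervalIntegral.integral_comp_add_right (fun θ => F (circleMap c r θ))] at h1
  have e1 : 0 + -Real.pi = -Real.pi := by ring
  have e2 : 2 * Real.pi + -Real.pi = Real.pi := by ring
  have hpi := Real.pi_pos
  rw [e1, e2, intervalIntegral.integral_of_le (by linarith), integral_Ioc_eq_integral_Ioo] at h1
  calc ‖F c‖ₑ * ENNReal.ofReal (2 * Real.pi)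
      = ‖(2 * Real.pi) • F c‖ₑ := by
        rw [enorm_smul, mul_comm, Real.enorm_of_nonneg (by positivity)]
    _ = ‖∫ θ in Set.Ioo (-Real.pi) Real.pi, F (circleMap c r θ)‖ₑ := by
        rw [← h1, smul_inv_smul₀ (by positivity)]
    _ ≤ _ := enorm_integral_le_lintegral_enorm _

/-- The sub-mean value property over discs, by integrating over circles in polar coordinates. -/
theorem enorm_mul_area_le_lintegral_ball {F : ℂ → ℂ} {c : ℂ} {δ : ℝ} (hδ : 0 < δ)
    (hF : DifferentiableOn ℂ F (Metric.ball c δ)) :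
    ‖F c‖ₑ * ENNReal.ofReal (Real.pi * δ ^ 2) ≤
      ∫⁻ w, (Metric.ball (0 : ℂ) δ).indicator (fun w => ‖F (c + w)‖ₑ) w := by
  set f : ℂ → ENNReal := (Metric.ball (0 : ℂ) δ).indicator (fun w => ‖F (c + w)‖ₑ) with hf
  have hmeas : Measurable f := by
    have hc : ContinuousOn (fun w => ‖F (c + w)‖ₑ) (Metric.ball (0 : ℂ) δ) := by
      refine continuous_enorm.comp_continuousOn (hF.continuousOn.comp (by fun_prop) ?_)
      intro w hw
      simpa using hw
    have hs : MeasurableSet (Metric.ball (0 : ℂ) δ) := Metric.isOpen_ball.measurableSet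
    refine measurable_of_restrict_of_restrict_compl hs ?_ ?_
    · have h : (Metric.ball (0 : ℂ) δ).domRestrict f =
          (Metric.ball (0 : ℂ) δ).domRestrict fun w => ‖F (c + w)‖ₑ := by
        ext w
        simp [hf]
      rw [h]
      exact (continuousOn_iff_continuous_domRestrict.1 hc).measurable
    · have h : (Metric.ball (0 : ℂ) δ)ᶜ.domRestrict f = fun _ => 0 := by
        ext w
        simp [hf, Set.indicator_of_notMem w.2]
      rw [h]
      exact measurable_const
  rw [← Complex.lintegral_comp_polarCoord_symm f]
  have hsub : Set.Ioo (0 : ℝ) δ ×ˢ Set.Ioo (-Real.pi) Real.pi ⊆ polarCoord.target := by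
    rw [polarCoord_target]
    exact Set.prod_mono (fun x hx => hx.1) le_rfl
  have hpolar : ∀ q : ℝ × ℝ, c + Complex.polarCoord.symm q = circleMap c q.1 q.2 := by
    intro q
    rw [Complex.polarCoord_symm_apply, circleMap, Complex.exp_mul_I]
    push_cast
    ring
  have hcont : Measurable fun q : ℝ × ℝ => ENNReal.ofReal q.1 • f (Complex.polarCoord.symm q) := by
    have h1 : Measurable fun q : ℝ × ℝ => (Complex.polarCoord.symm q : ℂ) := by
      simp_rw [Complex.polarCoord_symm_apply]
      fun_prop
    exact (ENNReal.measurable_ofReal.comp measurable_fst).mul (hmeas.comp h1)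
  refine le_trans ?_ (lintegral_mono_set hsub)
  rw [Measure.volume_eq_prod, ← Measure.prod_restrict, lintegral_prod _ hcont.aemeasurable]
  have hin : ∀ r ∈ Set.Ioo 0 δ, ENNReal.ofReal r * (‖F c‖ₑ * ENNReal.ofReal (2 * Real.pi)) ≤
      ∫⁻ θ in Set.Ioo (-Real.pi) Real.pi,
        ENNReal.ofReal r • f (Complex.polarCoord.symm (r, θ)) := by
    intro r hr
    simp only [smul_eq_mul]
    rw [lintegral_const_mul' _ _ ENNReal.ofReal_ne_top]
    gcongr
    refine (enorm_mul_two_pi_le_lintegral_circle hr.1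
      (hF.mono (Metric.closedBall_subset_ball hr.2))).trans (lintegral_mono fun θ => ?_)
    rw [hf, Set.indicator_of_mem, hpolar]
    rw [mem_ball_zero_iff]
    have h2 := hpolar (r, θ)
    rw [circleMap, add_right_inj] at h2
    rw [h2]
    simpa [abs_of_pos hr.1] using hr.2
  refine le_trans ?_ (setLIntegral_mono' measurableSet_Ioo hin)
  rw [lintegral_mul_const' _ _ (by finiteness)]
  have hr2 : ∫⁻ r in Set.Ioo 0 δ, ENNReal.ofReal r = ENNReal.ofReal (δ ^ 2 / 2) := by
    rw [← ofReal_integral_eq_lintegral_ofReal]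
    · rw [← integral_Ioc_eq_integral_Ioo, ← intervalIntegral.integral_of_le hδ.le, integral_id]
      simp
    · exact (continuous_id.integrableOn_Icc (a := (0:ℝ)) (b := δ)).mono_set Set.Ioo_subset_Icc_self
    · exact (ae_restrict_iff' measurableSet_Ioo).2 (Eventually.of_forall fun x hx => hx.1.le)
  rw [hr2, mul_left_comm, ← ENNReal.ofReal_mul (by positivity)]
  apply le_of_eq
  congr 2
  ring

namespace IsHardy

variable {p : ℝ} {K : NNReal} {F : ℂ → ℂ}

/-- Growth of a Hardy function at the boundary and decay at height infinity: average over the disc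
whose radius is half the height. -/
theorem exists_norm_le (hF : IsHardy p K F) (hp : 1 < p) :
    ∃ C : ℝ, 0 ≤ C ∧ ∀ z : ℂ, 0 < z.im → ‖F z‖ ≤ C * z.im ^ (-(1 / p)) := by
  refine ⟨4 * K / Real.pi, by positivity, fun z hz => ?_⟩
  set y := z.im with hy
  have hδ : 0 < y / 2 := by positivity
  have hball : ∀ w ∈ Metric.ball z (y / 2), 0 < w.im := by
    intro w hw
    rw [mem_ball_iff_norm] at hw
    have := (Complex.abs_im_le_norm (w - z)).trans_lt hw
    rw [Complex.sub_im, abs_lt] at this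
    linarith [this.1]
  have h1 := enorm_mul_area_le_lintegral_ball hδ (hF.differentiableOn.mono hball)
  have h2 : ∫⁻ w, (Metric.ball (0 : ℂ) (y / 2)).indicator (fun w => ‖F (z + w)‖ₑ) w ≤
      ENNReal.ofReal y * (K * ENNReal.ofReal y ^ (1 - 1 / p)) := by
    rw [← (Complex.volume_preserving_equiv_real_prod.symm).lintegral_comp_emb
      (MeasurableEquiv.measurableEmbedding _), Measure.volume_eq_prod, ← lintegral_prod_swap]
    refine (lintegral_prod_le _).trans ?_
    have hin : ∀ b : ℝ, (∫⁻ a : ℝ, (Metric.ball (0 : ℂ) (y / 2)).indicator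
        (fun w => ‖F (z + w)‖ₑ) (Complex.measurableEquivRealProd.symm (Prod.swap (b, a)))) ≤
        (Set.Ioo (-(y / 2)) (y / 2)).indicator
          (fun _ => K * ENNReal.ofReal y ^ (1 - 1 / p)) b := by
      intro b
      have hsymm : ∀ a : ℝ, Complex.measurableEquivRealProd.symm (Prod.swap (b, a)) = ⟨a, b⟩ :=
        fun a => rfl
      simp only [hsymm]
      by_cases hb : b ∈ Set.Ioo (-(y / 2)) (y / 2)
      · rw [Set.indicator_of_mem hb]
        have h0 := hF.setLIntegral_le hp (ρ := y + b) (by linarith [hb.1])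
          (Set.Ioo (z.re - y / 2) (z.re + y / 2))
        rw [Real.volume_Ioo, ← lintegral_indicator measurableSet_Ioo,
          ← lintegral_add_left_eq_self _ z.re] at h0
        have e : z.re + y / 2 - (z.re - y / 2) = y := by ring
        rw [e] at h0
        refine le_trans (lintegral_mono fun a => ?_) h0
        by_cases ha : (⟨a, b⟩ : ℂ) ∈ Metric.ball (0 : ℂ) (y / 2)
        · rw [Set.indicator_of_mem ha, Set.indicator_of_mem]
          · apply le_of_eq
            congr 2
            apply Complex.ext <;> simp [hy]
          · have h4 : |a| < y / 2 :=
              (Complex.abs_re_le_norm ⟨a, b⟩).trans_lt (mem_ball_zero_iff.1 ha)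
            rw [abs_lt] at h4
            constructor <;> linarith [h4.1, h4.2]
        · rw [Set.indicator_of_notMem ha]
          exact zero_le
      · rw [Set.indicator_of_notMem hb]
        refine ((lintegral_congr fun a =>
          Set.indicator_of_notMem (fun ha => hb ?_) _).trans lintegral_zero).le
        have h4 : |b| < y / 2 :=
          (Complex.abs_im_le_norm ⟨a, b⟩).trans_lt (mem_ball_zero_iff.1 ha)
        exact abs_lt.1 h4
    refine (lintegral_mono hin).trans ?_
    rw [lintegral_indicator measurableSet_Ioo, setLIntegral_const, Real.volume_Ioo, mul_comm]
    apply le_of_eq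
    congr 2
    ring
  have h3 := ENNReal.toReal_mono (by finiteness) (h1.trans h2)
  simp only [ENNReal.toReal_mul, toReal_enorm, ENNReal.coe_toReal, ← ENNReal.toReal_rpow] at h3
  rw [ENNReal.toReal_ofReal (by positivity), ENNReal.toReal_ofReal hz.le] at h3
  have h5 : y ^ (1 - 1 / p) = y * y ^ (-(1 / p)) := by
    rw [sub_eq_add_neg, Real.rpow_add hz, Real.rpow_one]
  rw [h5] at h3
  have hpi := Real.pi_pos
  rw [div_mul_eq_mul_div, le_div_iff₀ hpi]
  have hy2 : 0 < y ^ 2 := by positivity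
  refine le_of_mul_le_mul_left ?_ hy2
  linarith
end IsHardy

/-! ### Primitives up to the boundary -/

/-- A holomorphic function on the upper half-plane has a primitive, obtained from one on the unit
disc through the Cayley transform `z ↦ (z - i) / (z + i)`. -/
theorem exists_hasDerivAt_upper {F : ℂ → ℂ} (hF : DifferentiableOn ℂ F {z | 0 < z.im}) :
    ∃ G : ℂ → ℂ, ∀ z : ℂ, 0 < z.im → HasDerivAt G (F z) z := by
  have hne : ∀ w ∈ Metric.ball (0 : ℂ) 1, 1 - w ≠ 0 := by
    intro w hw h
    rw [mem_ball_zero_iff, ← sub_eq_zero.1 h] at hw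
    simp at hw
  have him : ∀ w ∈ Metric.ball (0 : ℂ) 1, 0 < (Complex.I * (1 + w) / (1 - w)).im := by
    intro w hw
    have h1 := Complex.normSq_pos.2 (hne w hw)
    have h2 : Complex.normSq w < 1 := by
      rw [Complex.normSq_eq_norm_sq]
      rw [mem_ball_zero_iff] at hw
      nlinarith [norm_nonneg w]
    have : (Complex.I * (1 + w) / (1 - w)).im =
        (1 - Complex.normSq w) / Complex.normSq (1 - w) := by
      rw [Complex.div_im]
      simp [Complex.normSq_apply]
      ring
    rw [this]
    exact div_pos (by linarith) h1
  have hdiff : DifferentiableOn ℂ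
      (fun w => F (Complex.I * (1 + w) / (1 - w)) * (2 * Complex.I / (1 - w) ^ 2))
      (Metric.ball 0 1) := by
    refine DifferentiableOn.mul (hF.comp ?_ him) ?_
    · exact DifferentiableOn.div (by fun_prop) (by fun_prop) hne
    · exact DifferentiableOn.div (by fun_prop) (by fun_prop) fun w hw => pow_ne_zero 2 (hne w hw)
  obtain ⟨P, hP⟩ := hdiff.isExactOn_ball
  refine ⟨fun z => P ((z - Complex.I) / (z + Complex.I)), fun z hz => ?_⟩
  have hz0 : z + Complex.I ≠ 0 := by
    intro h
    have := congrArg Complex.im h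
    simp at this
    linarith
  have hmem : (z - Complex.I) / (z + Complex.I) ∈ Metric.ball (0 : ℂ) 1 := by
    rw [mem_ball_zero_iff, norm_div, div_lt_one (norm_pos_iff.2 hz0),
      ← sq_lt_sq₀ (norm_nonneg _) (norm_nonneg _), ← Complex.normSq_eq_norm_sq,
      ← Complex.normSq_eq_norm_sq]
    simp [Complex.normSq_apply]
    nlinarith
  have hψ : HasDerivAt (fun z : ℂ => (z - Complex.I) / (z + Complex.I))
      (2 * Complex.I / (z + Complex.I) ^ 2) z := by
    convert! ((hasDerivAt_id z).sub_const Complex.I).div ((hasDerivAt_id z).add_const Complex.I)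
      hz0 using 1
    simp
    ring
  have h := (hP _ hmem).comp z hψ
  convert! h using 1
  have e1 : 1 - (z - Complex.I) / (z + Complex.I) = 2 * Complex.I / (z + Complex.I) := by
    field_simp
    ring
  have e2 : Complex.I * (1 + (z - Complex.I) / (z + Complex.I)) /
      (2 * Complex.I / (z + Complex.I)) = z := by
    field_simp
    ring
  beta_reduce
  rw [e1, e2]
  field_simp

/-- Along vertical segments a primitive of `F = O((Im z)^{-1/p})` is Hölder continuous of exponent
`1 - 1/p`. -/
theorem norm_sub_le_vertical {F G : ℂ → ℂ} {C p : ℝ} (hp : 1 < p) (hC0 : 0 ≤ C)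
    (hC : ∀ z : ℂ, 0 < z.im → ‖F z‖ ≤ C * z.im ^ (-(1 / p)))
    (hG : ∀ z : ℂ, 0 < z.im → HasDerivAt G (F z) z) {z : ℂ} (hz : 0 ≤ z.im) {s t : ℝ}
    (hs : 0 < s) (hst : s ≤ t) :
    ‖G (z + t * Complex.I) - G (z + s * Complex.I)‖ ≤ C / (1 - 1 / p) * t ^ (1 - 1 / p) := by
  have hα : 0 < 1 - 1 / p := by
    rw [sub_pos, div_lt_one (by linarith)]
    exact hp
  have him : ∀ τ : ℝ, (z + τ * Complex.I).im = z.im + τ := by simp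
  have hder : ∀ τ : ℝ, 0 < τ → HasDerivAt (fun τ : ℝ => G (z + τ * Complex.I) -
      G (z + s * Complex.I)) (F (z + τ * Complex.I) * Complex.I) τ := by
    intro τ hτ
    have h1 : HasDerivAt (fun τ : ℝ => z + τ * Complex.I) Complex.I τ := by
      simpa using ((Complex.ofRealCLM.hasDerivAt (x := τ)).mul_const Complex.I).const_add z
    exact ((hG _ (by rw [him]; linarith)).comp τ h1).sub_const _
  have hB : ∀ τ : ℝ, 0 < τ → HasDerivAt (fun τ : ℝ => C / (1 - 1 / p) *
      (τ ^ (1 - 1 / p) - s ^ (1 - 1 / p))) (C * τ ^ (-(1 / p))) τ := by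
    intro τ hτ
    convert! ((Real.hasDerivAt_rpow_const (p := 1 - 1 / p) (Or.inl hτ.ne')).sub_const
      (s ^ (1 - 1 / p))).const_mul (C / (1 - 1 / p)) using 1
    rw [← mul_assoc, div_mul_cancel₀ _ hα.ne']
    congr 2
    ring
  have h := image_norm_le_of_norm_deriv_right_le_deriv_boundary'
    (f := fun τ : ℝ => G (z + τ * Complex.I) - G (z + s * Complex.I)) (a := s) (b := t)
    (f' := fun τ => F (z + τ * Complex.I) * Complex.I)
    (fun τ hτ => (hder τ (hs.trans_le hτ.1)).continuousAt.continuousWithinAt)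
    (fun τ hτ => (hder τ (hs.trans_le hτ.1)).hasDerivWithinAt)
    (B := fun τ => C / (1 - 1 / p) * (τ ^ (1 - 1 / p) - s ^ (1 - 1 / p)))
    (B' := fun τ => C * τ ^ (-(1 / p))) (by simp)
    (fun τ hτ => (hB τ (hs.trans_le hτ.1)).continuousAt.continuousWithinAt)
    (fun τ hτ => (hB τ (hs.trans_le hτ.1)).hasDerivWithinAt)
    (fun τ hτ => by
      have hτ0 := hs.trans_le hτ.1
      rw [norm_mul, Complex.norm_I, mul_one]
      refine (hC _ (by rw [him]; linarith)).trans ?_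
      gcongr C * ?_
      refine Real.rpow_le_rpow_of_nonpos hτ0 (by rw [him]; linarith) ?_
      rw [neg_nonpos]
      positivity)
    (Set.right_mem_Icc.2 hst)
  refine h.trans ?_
  gcongr
  simpa using Real.rpow_nonneg hs.le _

/-- A primitive of a function that is `O((Im z)^{-1/p})` extends continuously to the real line and
grows at most linearly. -/
theorem exists_primitive_continuousOn {F : ℂ → ℂ} {C p : ℝ} (hp : 1 < p) (hC0 : 0 ≤ C)
    (hF : DifferentiableOn ℂ F {z | 0 < z.im})
    (hC : ∀ z : ℂ, 0 < z.im → ‖F z‖ ≤ C * z.im ^ (-(1 / p))) :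
    ∃ G : ℂ → ℂ, ContinuousOn G {z | 0 ≤ z.im} ∧ (∀ z : ℂ, 0 < z.im → HasDerivAt G (F z) z) ∧
      ∃ A : ℝ, 0 ≤ A ∧ ∀ z : ℂ, 0 ≤ z.im → ‖G z‖ ≤ A * (1 + ‖z‖) := by
  obtain ⟨G, hG⟩ := exists_hasDerivAt_upper hF
  have hα : 0 < 1 - 1 / p := by
    rw [sub_pos, div_lt_one (by linarith)]
    exact hp
  set u : ℕ → ℝ := fun n => 1 / ((n : ℝ) + 1) with hu
  have hu0 : ∀ n, 0 < u n := fun n => by positivity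
  have hulim : Tendsto u atTop (𝓝 0) := tendsto_one_div_add_atTop_nhds_zero_nat
  have hbound : Tendsto (fun n => C / (1 - 1 / p) * u n ^ (1 - 1 / p)) atTop (𝓝 0) := by
    have h := (hulim.rpow_const (p := 1 - 1 / p) (Or.inr hα.le)).const_mul (C / (1 - 1 / p))
    rwa [Real.zero_rpow hα.ne', mul_zero] at h
  have hanti : Antitone u := fun m n hmn => by
    simp only [hu]
    gcongr
  have hcauchy : UniformCauchySeqOn (fun n (z : ℂ) => G (z + u n * Complex.I)) atTop
      {z | 0 ≤ z.im} := by
    rw [Metric.uniformCauchySeqOn_iff]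
    intro ε hε
    obtain ⟨N, hN⟩ := eventually_atTop.1 (hbound.eventually (gt_mem_nhds hε))
    have key : ∀ m ≥ N, ∀ n ≥ m, ∀ z ∈ {z : ℂ | 0 ≤ z.im},
        dist (G (z + u m * Complex.I)) (G (z + u n * Complex.I)) < ε := by
      intro m hm n hn z hz
      rw [dist_eq_norm]
      exact (norm_sub_le_vertical hp hC0 hC hG hz (hu0 n) (hanti hn)).trans_lt (hN m hm)
    refine ⟨N, fun m hm n hn z hz => ?_⟩
    rcases le_total m n with h | h
    · exact key m hm n h z hz
    · rw [dist_comm]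
      exact key n hn m h z hz
  have hlim : ∀ z ∈ {z : ℂ | 0 ≤ z.im}, Tendsto (fun n => G (z + u n * Complex.I)) atTop
      (𝓝 (limUnder atTop fun n => G (z + u n * Complex.I))) := fun z hz =>
    tendsto_nhds_limUnder (cauchySeq_tendsto_of_complete (hcauchy.cauchySeq hz))
  have hunif := hcauchy.tendstoUniformlyOn_of_tendsto hlim
  have hcont : ContinuousOn (fun z => limUnder atTop fun n => G (z + u n * Complex.I))
      {z | 0 ≤ z.im} := by
    refine hunif.continuousOn (Frequently.of_forall fun n z hz => ?_)
    have h1 : 0 < (z + u n * Complex.I).im := by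
      have := hu0 n
      simp at hz ⊢
      linarith
    exact ((hG _ h1).continuousAt.comp (f := fun z : ℂ => z + u n * Complex.I)
      (by fun_prop)).continuousWithinAt
  have heq : ∀ z : ℂ, 0 < z.im → (limUnder atTop fun n => G (z + u n * Complex.I)) = G z := by
    intro z hz
    have h1 : Tendsto (fun n => z + u n * Complex.I) atTop (𝓝 z) := by
      have h2 : Tendsto (fun n => ((u n : ℝ) : ℂ)) atTop (𝓝 0) :=
        (Complex.continuous_ofReal.tendsto' 0 0 Complex.ofReal_zero).comp hulim
      simpa using (h2.mul_const Complex.I).const_add z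
    exact ((hG z hz).continuousAt.tendsto.comp h1).limUnder_eq
  set A : ℝ := ‖G Complex.I‖ + C + C / (1 - 1 / p) with hA
  have hq : 0 ≤ C / (1 - 1 / p) := div_nonneg hC0 hα.le
  have hA0 : 0 ≤ A := by positivity
  -- Above height one `G` is Lipschitz.
  have hhigh : ∀ z : ℂ, 1 ≤ z.im → ‖G z - G Complex.I‖ ≤ C * ‖z - Complex.I‖ := by
    intro z hz
    have hconv : Convex ℝ {z : ℂ | 1 ≤ z.im} := convex_halfSpace_im_ge 1
    refine hconv.norm_image_sub_le_of_norm_hasDerivWithin_le (f' := F)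
      (fun w hw => (hG w (lt_of_lt_of_le one_pos hw)).hasDerivWithinAt) (fun w hw => ?_)
      (show (1 : ℝ) ≤ Complex.I.im by simp) hz
    have hw1 : (1 : ℝ) ≤ w.im := hw
    refine (hC w (by linarith)).trans (mul_le_of_le_one_right hC0 ?_)
    exact Real.rpow_le_one_of_one_le_of_nonpos hw1 (neg_nonpos.2 (by positivity))
  have hgrow : ∀ z : ℂ, 0 < z.im → ‖G z‖ ≤ A * (1 + ‖z‖) := by
    intro z hz
    rcases le_total 1 z.im with h | h
    · have h1 := hhigh z h
      have h2 : ‖z - Complex.I‖ ≤ 1 + ‖z‖ := by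
        refine (norm_sub_le _ _).trans ?_
        simp [add_comm]
      have h3 := norm_le_norm_add_norm_sub (G Complex.I) (G z)
      rw [norm_sub_rev] at h3
      nlinarith [norm_nonneg z, norm_nonneg (G Complex.I)]
    · have h1 := hhigh (z.re + (1 : ℝ) * Complex.I) (by simp)
      have h2 := norm_sub_le_vertical hp hC0 hC hG (z := z.re) (by simp) hz h
      rw [Complex.re_add_im, Real.one_rpow, mul_one] at h2
      have h4 : ‖(z.re + (1 : ℝ) * Complex.I : ℂ) - Complex.I‖ ≤ ‖z‖ := by
        simpa using Complex.abs_re_le_norm z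
      have h5 : ‖G z‖ ≤ ‖G Complex.I‖ + ‖G (z.re + (1 : ℝ) * Complex.I) - G Complex.I‖ +
          ‖G (z.re + (1 : ℝ) * Complex.I) - G z‖ := by
        have : G z = G Complex.I + (G (z.re + (1 : ℝ) * Complex.I) - G Complex.I) -
          (G (z.re + (1 : ℝ) * Complex.I) - G z) := by ring
        calc ‖G z‖ = _ := congrArg norm this
          _ ≤ _ := (norm_sub_le _ _).trans (by gcongr; exact norm_add_le _ _)
      nlinarith [norm_nonneg z, norm_nonneg (G Complex.I)]
  refine ⟨fun z => limUnder atTop fun n => G (z + u n * Complex.I), hcont, fun z hz => ?_, A, hA0,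
    fun z hz => ?_⟩
  · refine (hG z hz).congr_of_eventuallyEq ?_
    filter_upwards [isOpen_upper.mem_nhds hz] with w hw using heq w hw
  · have hcl : closure {z : ℂ | 0 < z.im} = {z | 0 ≤ z.im} := Complex.closure_setOfPred_lt_im 0
    refine le_on_closure (s := {z : ℂ | 0 < z.im}) (fun w hw => ?_) (by rw [hcl]; exact hcont.norm)
      (by fun_prop : ContinuousOn (fun z : ℂ => A * (1 + ‖z‖)) _) (by rw [hcl]; exact hz)
    rw [heq w hw]
    exact hgrow w hw

/-! ### Differentiability at a boundary point -/

/-- The maximum principle on the upper half-plane, for functions which are small near infinity. -/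
theorem norm_le_of_upper {f : ℂ → ℂ} {δ : ℝ} (hd : DifferentiableOn ℂ f {z | 0 < z.im})
    (hc : ContinuousOn f {z | 0 ≤ z.im}) (hreal : ∀ x : ℝ, ‖f x‖ ≤ δ) {R : ℝ}
    (hinf : ∀ z : ℂ, 0 ≤ z.im → R ≤ ‖z‖ → ‖f z‖ ≤ δ) {z : ℂ} (hz : 0 < z.im) : ‖f z‖ ≤ δ := by
  rcases le_or_gt R ‖z‖ with h | h
  · exact hinf z hz.le h
  have hR : 0 < R := (norm_nonneg z).trans_lt h
  have hcl : closure {z : ℂ | 0 < z.im} = {z | 0 ≤ z.im} := Complex.closure_setOfPred_lt_im 0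
  have hfr : frontier {z : ℂ | 0 < z.im} = {z | z.im = 0} := Complex.frontier_setOfPred_lt_im 0
  set U : Set ℂ := {z : ℂ | 0 < z.im} ∩ Metric.ball 0 R with hU
  have hclU : closure U ⊆ {z | 0 ≤ z.im} := by
    rw [← hcl]
    exact closure_mono Set.inter_subset_left
  refine Complex.norm_le_of_forall_mem_frontier_norm_le (U := U)
    (Metric.isBounded_ball.subset Set.inter_subset_right)
    ⟨hd.mono Set.inter_subset_left, hc.mono hclU⟩ (fun w hw => ?_)
    (subset_closure ⟨hz, mem_ball_zero_iff.2 h⟩)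
  have hw0 : 0 ≤ w.im := hclU (frontier_subset_closure hw)
  rcases frontier_inter_subset _ _ hw with h1 | h1
  · rw [hfr] at h1
    have h2 : w = (w.re : ℂ) := Complex.ext (by simp) (by simpa using h1.1)
    rw [h2]
    exact hreal _
  · rw [frontier_ball _ hR.ne'] at h1
    exact hinf w hw0 (mem_sphere_zero_iff_norm.1 h1.2).ge

/-- A holomorphic function of at most linear growth on the upper half-plane, continuous up to the
real line, which is `o(x)` at `0` along the real line is `o(z)` in the whole half-plane. The proof
applies the maximum principle to `z g(z) / ((1 - i k z) (z + i η)²)`: the factor `1 - i k z` deals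
with the real points away from `0`, and `(z + i η)²` with the singularity of `g(z) / z` at `0`. -/
theorem isLittleO_upper_of_real {g : ℂ → ℂ} {A : ℝ} (hA : 0 ≤ A)
    (hd : DifferentiableOn ℂ g {z | 0 < z.im}) (hc : ContinuousOn g {z | 0 ≤ z.im})
    (hgrow : ∀ z : ℂ, 0 ≤ z.im → ‖g z‖ ≤ A * (1 + ‖z‖))
    (hreal : (fun x : ℝ => g x) =o[𝓝 0] fun x : ℝ => x) :
    g =o[𝓝[{z | 0 < z.im}] 0] fun z : ℂ => z := by
  rw [Asymptotics.isLittleO_iff]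
  intro ε hε
  set δ := ε / 2 with hδ
  have hδ0 : 0 < δ := by positivity
  obtain ⟨r, hr0, hr⟩ := Metric.eventually_nhds_iff.1 (Asymptotics.isLittleO_iff.1 hreal hδ0)
  -- `k` makes the linear growth bound at `|x| = r` at most `δ |x| |1 - i k x|`.
  set k : ℝ := A * (1 + r) / (r ^ 2 * δ) + 1 with hk
  have hk0 : 0 < k := by positivity
  have hkr : A * (1 + r) ≤ k * (r ^ 2 * δ) := by
    rw [hk, add_mul, div_mul_cancel₀ _ (by positivity)]
    have : 0 < r ^ 2 * δ := by positivity
    linarith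
  -- Lower bounds for the two denominators.
  have hden1 : ∀ z : ℂ, 0 ≤ z.im → 1 ≤ ‖1 - Complex.I * k * z‖ := by
    intro z hz
    refine le_trans ?_ (Complex.re_le_norm _)
    simp
    positivity
  have hden2 : ∀ z : ℂ, 0 ≤ z.im → k * ‖z‖ ≤ ‖1 - Complex.I * k * z‖ := by
    intro z hz
    have : k * ‖z‖ = ‖(k : ℂ) * z‖ := by simp [abs_of_pos hk0]
    rw [this, ← sq_le_sq₀ (norm_nonneg _) (norm_nonneg _), ← Complex.normSq_eq_norm_sq,
      ← Complex.normSq_eq_norm_sq]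
    simp [Complex.normSq_apply]
    nlinarith [mul_nonneg hk0.le hz]
  have hden3 : ∀ (η : ℝ) (z : ℂ), 0 < η → 0 ≤ z.im → ‖z‖ ≤ ‖z + Complex.I * η‖ := by
    intro η z hη hz
    rw [← sq_le_sq₀ (norm_nonneg _) (norm_nonneg _), ← Complex.normSq_eq_norm_sq,
      ← Complex.normSq_eq_norm_sq]
    simp [Complex.normSq_apply]
    nlinarith [mul_nonneg hη.le hz]
  have hne : ∀ (η : ℝ) (z : ℂ), 0 < η → 0 ≤ z.im → z + Complex.I * η ≠ 0 := by
    intro η z hη hz h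
    have := congrArg Complex.im h
    simp at this
    linarith
  have hne1 : ∀ z : ℂ, 0 ≤ z.im → 1 - Complex.I * k * z ≠ 0 := fun z hz =>
    norm_pos_iff.1 (one_pos.trans_le (hden1 z hz))
  -- The bound on the real line.
  have hline : ∀ x : ℝ, ‖g x‖ ≤ δ * ‖(x : ℂ)‖ * ‖1 - Complex.I * k * (x : ℂ)‖ := by
    intro x
    rcases lt_or_ge |x| r with h | h
    · have h1 := hr (y := x) (by simpa using h)
      rw [Complex.norm_real]
      exact h1.trans (le_mul_of_one_le_right (by positivity) (hden1 x (by simp)))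
    · have h1 := hgrow x (by simp)
      have h2 := hden2 x (by simp)
      rw [Complex.norm_real, Real.norm_eq_abs] at *
      refine h1.trans ?_
      calc A * (1 + |x|) ≤ δ * |x| * (k * |x|) := by
            have h3 : A * (1 + |x|) * r ^ 2 ≤ A * (1 + r) * |x| ^ 2 := by
              rw [mul_assoc, mul_assoc]
              gcongr A * ?_
              nlinarith [mul_nonneg hr0.le (abs_nonneg x), mul_nonneg (mul_nonneg hr0.le
                (abs_nonneg x)) (sub_nonneg.2 h)]
            have h4 : A * (1 + r) * |x| ^ 2 ≤ k * (r ^ 2 * δ) * |x| ^ 2 := by gcongr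
            have h5 : 0 < r ^ 2 := by positivity
            refine le_of_mul_le_mul_right ?_ h5
            linarith
        _ ≤ _ := by gcongr
  -- The bound in the half-plane.
  have hmain : ∀ z : ℂ, 0 < z.im → ∀ η : ℝ, 0 < η →
      ‖z * g z / ((1 - Complex.I * k * z) * (z + Complex.I * η) ^ 2)‖ ≤ δ := by
    intro z hz η hη
    refine norm_le_of_upper (R := max 1 (2 * A / (k * δ)))
      (f := fun z => z * g z / ((1 - Complex.I * k * z) * (z + Complex.I * η) ^ 2))
      ?_ ?_ ?_ ?_ hz
    · refine DifferentiableOn.div (differentiableOn_id.mul hd) (by fun_prop) fun w hw => ?_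
      exact mul_ne_zero (hne1 w (le_of_lt hw)) (pow_ne_zero 2 (hne η w hη (le_of_lt hw)))
    · refine ContinuousOn.div (continuousOn_id.mul hc) (by fun_prop) fun w hw => ?_
      exact mul_ne_zero (hne1 w hw) (pow_ne_zero 2 (hne η w hη hw))
    · intro x
      have h1 : 0 < ‖1 - Complex.I * k * (x : ℂ)‖ := norm_pos_iff.2 (hne1 x (by simp))
      have h2 : 0 < ‖(x : ℂ) + Complex.I * η‖ := norm_pos_iff.2 (hne η x hη (by simp))
      rw [norm_div, norm_mul, norm_mul, norm_pow, div_le_iff₀ (by positivity)]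
      calc ‖(x : ℂ)‖ * ‖g x‖ ≤ ‖(x : ℂ)‖ * (δ * ‖(x : ℂ)‖ * ‖1 - Complex.I * k * (x : ℂ)‖) := by
            gcongr
            exact hline x
        _ = δ * (‖1 - Complex.I * k * (x : ℂ)‖ * ‖(x : ℂ)‖ ^ 2) := by ring
        _ ≤ _ := by
            gcongr
            exact hden3 η x hη (by simp)
    · intro w hw hwR
      have hw1 : 1 ≤ ‖w‖ := (le_max_left _ _).trans hwR
      have hw2 : 2 * A ≤ ‖w‖ * (k * δ) := by
        rw [← div_le_iff₀ (by positivity)]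
        exact (le_max_right _ _).trans hwR
      have h1 : 0 < ‖1 - Complex.I * k * w‖ := norm_pos_iff.2 (hne1 w hw)
      have h2 : 0 < ‖w + Complex.I * η‖ := norm_pos_iff.2 (hne η w hη hw)
      rw [norm_div, norm_mul, norm_mul, norm_pow, div_le_iff₀ (by positivity)]
      calc ‖w‖ * ‖g w‖ ≤ ‖w‖ * (A * (1 + ‖w‖)) := by
            gcongr
            exact hgrow w hw
        _ ≤ ‖w‖ * (A * (‖w‖ + ‖w‖)) := by gcongr
        _ = ‖w‖ ^ 2 * (2 * A) := by ring
        _ ≤ ‖w‖ ^ 2 * (‖w‖ * (k * δ)) := by gcongr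
        _ = δ * ((k * ‖w‖) * ‖w‖ ^ 2) := by ring
        _ ≤ _ := by
            gcongr
            · exact hden2 w hw
            · exact hden3 η w hη hw
  -- Let `η` tend to `0`.
  have hlim : ∀ z : ℂ, 0 < z.im → ‖g z‖ ≤ δ * (‖1 - Complex.I * k * z‖ * ‖z‖) := by
    intro z hz
    have hz0 : z ≠ 0 := by
      rintro rfl
      simp at hz
    have h1 : 0 < ‖1 - Complex.I * k * z‖ := norm_pos_iff.2 (hne1 z hz.le)
    have h2 : ∀ η : ℝ, 0 < η → ‖z‖ * ‖g z‖ ≤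
        δ * (‖1 - Complex.I * k * z‖ * ‖z + Complex.I * η‖ ^ 2) := by
      intro η hη
      have h3 : 0 < ‖z + Complex.I * η‖ := norm_pos_iff.2 (hne η z hη hz.le)
      have h4 := hmain z hz η hη
      rwa [norm_div, norm_mul, norm_mul, norm_pow, div_le_iff₀ (by positivity)] at h4
    have h3 : Tendsto (fun η : ℝ => δ * (‖1 - Complex.I * k * z‖ * ‖z + Complex.I * η‖ ^ 2))
        (𝓝[>] 0) (𝓝 (δ * (‖1 - Complex.I * k * z‖ * ‖z‖ ^ 2))) := by
      refine (Continuous.tendsto' ?_ _ _ (by simp)).mono_left nhdsWithin_le_nhds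
      fun_prop
    have h4 := ge_of_tendsto h3 (eventually_mem_nhdsWithin.mono h2)
    refine le_of_mul_le_mul_left ?_ (norm_pos_iff.2 hz0)
    linarith
  have hsmall : ∀ᶠ z : ℂ in 𝓝 0, ‖1 - Complex.I * k * z‖ < 2 := by
    have h : Tendsto (fun z : ℂ => ‖1 - Complex.I * k * z‖) (𝓝 0) (𝓝 1) :=
      Continuous.tendsto' (by fun_prop) _ _ (by simp)
    exact h.eventually (gt_mem_nhds (by norm_num))
  filter_upwards [eventually_mem_nhdsWithin, nhdsWithin_le_nhds hsmall] with z hz hz2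
  refine (hlim z hz).trans ?_
  have : δ * (‖1 - Complex.I * k * z‖ * ‖z‖) ≤ δ * (2 * ‖z‖) := by gcongr
  refine this.trans (le_of_eq ?_)
  rw [hδ]
  ring

/-- If a primitive `G` of `F` on the upper half-plane, continuous up to the real line, is
differentiable along the real line at `x`, then `F` has the vertical limit `G'(x)` at `x`: the
remainder `G(x + z) - G(x) - z G'(x)` is `o(z)` in the half-plane, and Cauchy's estimate on the disc
of centre `iε` and radius `ε / 2` bounds its derivative at `iε`. -/
theorem tendsto_vertical_of_hasDerivAt {F G : ℂ → ℂ} {A x : ℝ} {L : ℂ} (hA : 0 ≤ A)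
    (hc : ContinuousOn G {z | 0 ≤ z.im}) (hG : ∀ z : ℂ, 0 < z.im → HasDerivAt G (F z) z)
    (hgrow : ∀ z : ℂ, 0 ≤ z.im → ‖G z‖ ≤ A * (1 + ‖z‖))
    (hL : HasDerivAt (fun t : ℝ => G t) L x) :
    Tendsto (fun ε : ℝ => F (x + ε * Complex.I)) (𝓝[>] 0) (𝓝 L) := by
  set g : ℂ → ℂ := fun z => G (x + z) - G x - z * L with hg
  have hder : ∀ z : ℂ, 0 < z.im → HasDerivAt g (F (x + z) - L) z := by
    intro z hz
    have h1 : HasDerivAt (fun z => G (x + z)) (F (x + z)) z :=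
      HasDerivAt.comp_const_add (x : ℂ) z (hG (x + z) (by simpa using hz))
    convert! (h1.sub_const (G x)).sub ((hasDerivAt_id z).mul_const L) using 1
    simp
  have hgo : g =o[𝓝[{z | 0 < z.im}] 0] fun z : ℂ => z := by
    refine isLittleO_upper_of_real (A := A * (1 + |x|) + A * (1 + |x|) + A + ‖L‖) (by positivity)
      (fun z hz => (hder z hz).differentiableAt.differentiableWithinAt) ?_ (fun z hz => ?_) ?_
    · refine ((hc.comp (by fun_prop) fun z hz => ?_).sub continuousOn_const).sub (by fun_prop)
      simpa using hz
    · have h1 := hgrow (x + z) (by simpa using hz)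
      have h2 := hgrow x (by simp)
      have h3 : ‖(x : ℂ) + z‖ ≤ |x| + ‖z‖ := by
        simpa using norm_add_le (x : ℂ) z
      rw [Complex.norm_real, Real.norm_eq_abs] at h2
      have h4 : ‖g z‖ ≤ ‖G (x + z)‖ + ‖G x‖ + ‖z‖ * ‖L‖ := by
        rw [← norm_mul]
        exact (norm_sub_le _ _).trans (by gcongr; exact norm_sub_le _ _)
      have h5 : A * (1 + ‖(x : ℂ) + z‖) ≤ A * (1 + (|x| + ‖z‖)) := by gcongr
      have h6 : 0 ≤ A * (1 + |x|) * ‖z‖ := by positivity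
      nlinarith [norm_nonneg z, norm_nonneg L]
    · have h := (hasDerivAt_iff_isLittleO_nhds_zero.1 hL)
      simpa [hg] using h
  rw [Metric.tendsto_nhds]
  intro ε hε
  obtain ⟨r, hr0, hr⟩ := Metric.mem_nhdsWithin_iff.1
    (Asymptotics.isLittleO_iff.1 hgo (c := ε / 4) (by positivity))
  filter_upwards [Ioo_mem_nhdsGT (show (0 : ℝ) < r / 2 by positivity)] with t ht
  have hball : ∀ w ∈ Metric.closedBall ((t : ℂ) * Complex.I) (t / 2),
      0 < w.im ∧ ‖w‖ ≤ 3 * t / 2 := by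
    intro w hw
    rw [mem_closedBall_iff_norm] at hw
    constructor
    · have := (Complex.abs_im_le_norm _).trans hw
      rw [abs_le] at this
      simp at this
      linarith [this.1, ht.1]
    · have h1 := norm_le_norm_add_norm_sub ((t : ℂ) * Complex.I) w
      rw [norm_sub_rev] at hw
      simp [abs_of_pos ht.1] at h1
      rw [norm_sub_rev] at h1 hw
      linarith
  have hdiff : DiffContOnCl ℂ g (Metric.ball ((t : ℂ) * Complex.I) (t / 2)) := by
    refine DifferentiableOn.diffContOnCl fun w hw => ?_
    rw [closure_ball _ (by linarith [ht.1])] at hw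
    exact (hder w (hball w hw).1).differentiableAt.differentiableWithinAt
  have hest := Complex.norm_deriv_le_of_forall_mem_sphere_norm_le (C := ε / 4 * (3 * t / 2))
    (half_pos ht.1) hdiff fun w hw => by
      have h1 := hball w (Metric.sphere_subset_closedBall hw)
      have h2 := hr (a := w) ⟨mem_ball_zero_iff.2 (by linarith [ht.2, h1.2]), h1.1⟩
      exact (show ‖g w‖ ≤ ε / 4 * ‖w‖ from h2).trans (by gcongr; exact h1.2)
  rw [(hder _ (by simpa using ht.1)).deriv] at hest
  rw [dist_eq_norm]
  refine hest.trans_lt ?_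
  rw [div_lt_iff₀ (half_pos ht.1)]
  nlinarith [ht.1]

/-! ### Boundary values almost everywhere and uniform integrability -/

theorem tendsto_div_add_one_nhdsGT {δ : ℝ} (hδ : 0 < δ) :
    Tendsto (fun n : ℕ => δ / ((n : ℝ) + 1)) atTop (𝓝[>] 0) := by
  refine tendsto_nhdsWithin_iff.2 ⟨?_, Eventually.of_forall fun n => ?_⟩
  · simpa [div_eq_mul_inv] using tendsto_one_div_add_atTop_nhds_zero_nat.const_mul δ
  · exact div_pos hδ (by positivity)

/-- The total variation of a function with continuous derivative is at most the integral of the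
norm of the derivative. -/
theorem eVariationOn_Icc_le_lintegral {f f' : ℝ → ℂ} (hf : ∀ x, HasDerivAt f (f' x) x)
    (hf' : Continuous f') (a b : ℝ) :
    eVariationOn f (Set.Icc a b) ≤ ∫⁻ x in Set.Icc a b, ‖f' x‖ₑ := by
  refine iSup_le fun q => ?_
  obtain ⟨n, u, hu, hmem⟩ := q
  have hstep : ∀ i ∈ Finset.range n, edist (f (u (i + 1))) (f (u i)) ≤
      ∫⁻ x in Set.Ioc (u i) (u (i + 1)), ‖f' x‖ₑ := by
    intro i _
    rw [edist_eq_enorm_sub, ← intervalIntegral.integral_eq_sub_of_hasDerivAt (fun x _ => hf x)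
      (hf'.intervalIntegrable _ _), intervalIntegral.integral_of_le (hu (Nat.le_succ i))]
    exact enorm_integral_le_lintegral_enorm _
  refine (Finset.sum_le_sum hstep).trans ?_
  rw [← lintegral_biUnion_finset (t := fun i => Set.Ioc (u i) (u (i + 1)))
    (fun i _ j _ hij => hu.pairwise_disjoint_on_Ioc_succ hij) (fun i _ => measurableSet_Ioc)]
  refine lintegral_mono_set (Set.iUnion₂_subset fun i _ x hx => ?_)
  exact ⟨(hmem i).1.trans hx.1.le, hx.2.trans (hmem (i + 1)).2⟩

/-- Integrals of an almost everywhere convergent sequence bounded in `L^p`, `p > 1`, on a finite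
measure space converge: such a sequence is uniformly integrable. -/
theorem tendsto_integral_of_eLpNorm_le {X : Type*} [MeasurableSpace X] {μ : Measure X}
    [IsFiniteMeasure μ] {p : ℝ} (hp : 1 < p) {K : ENNReal} (hK : K ≠ ⊤) {f : ℕ → X → ℂ}
    {g : X → ℂ} (hf : ∀ n, AEStronglyMeasurable (f n) μ)
    (hb : ∀ n, eLpNorm (f n) (ENNReal.ofReal p) μ ≤ K)
    (hlim : ∀ᵐ x ∂μ, Tendsto (fun n => f n x) atTop (𝓝 (g x))) :
    Integrable g μ ∧ Tendsto (fun n => ∫ x, f n x ∂μ) atTop (𝓝 (∫ x, g x ∂μ)) := by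
  have hp1 : (1 : ENNReal) ≤ ENNReal.ofReal p := by simpa using hp.le
  have hα : 0 < 1 - 1 / p := by
    rw [sub_pos, div_lt_one (by linarith)]
    exact hp
  have hgm : AEStronglyMeasurable g μ := aestronglyMeasurable_of_tendsto_ae atTop hf hlim
  have hg : MemLp g (ENNReal.ofReal p) μ := by
    refine ⟨hgm, (Lp.eLpNorm_lim_le_liminf_eLpNorm hf g hlim).trans_lt ?_⟩
    refine lt_of_le_of_lt ?_ hK.lt_top
    exact (liminf_le_liminf (Eventually.of_forall hb)).trans_eq (liminf_const K)
  have hfi : ∀ n, MemLp (f n) 1 μ := fun n =>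
    MemLp.mono_exponent (q := ENNReal.ofReal p) ⟨hf n, (hb n).trans_lt hK.lt_top⟩ hp1
  have hunif : UnifIntegrable f 1 μ := by
    have ht : Tendsto (fun t : ℝ => K * ENNReal.ofReal t ^ (1 - 1 / p)) (𝓝[>] 0) (𝓝 0) := by
      have h1 : Tendsto (fun t : ℝ => ENNReal.ofReal t ^ (1 - 1 / p)) (𝓝[>] 0) (𝓝 0) := by
        refine (Continuous.tendsto' ?_ _ _ ?_).mono_left nhdsWithin_le_nhds
        · exact ENNReal.continuous_rpow_const.comp ENNReal.continuous_ofReal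
        · simp only [ENNReal.ofReal_zero]
          exact ENNReal.zero_rpow_of_pos hα
      simpa using ENNReal.Tendsto.const_mul h1 (Or.inr hK)
    intro ε hε
    obtain ⟨δ, hδ, hδ0⟩ := ((ht.eventually (ge_mem_nhds (ENNReal.ofReal_pos.2 hε))).and
      eventually_mem_nhdsWithin).exists
    refine ⟨δ, hδ0, fun n s hs hμ => ?_⟩
    rw [eLpNorm_indicator_eq_eLpNorm_restrict hs]
    refine (eLpNorm_le_eLpNorm_mul_rpow_measure_univ hp1 (hf n).restrict).trans (le_trans ?_ hδ)
    rw [Measure.restrict_apply_univ, ENNReal.toReal_ofReal (by linarith)]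
    simp only [ENNReal.toReal_one, div_one]
    gcongr
    exact (eLpNorm_mono_measure _ Measure.restrict_le_self).trans (hb n)
  have hL1 := tendsto_Lp_finite_of_tendsto_ae le_rfl ENNReal.one_ne_top hf
    (hg.mono_exponent hp1) hunif hlim
  refine ⟨memLp_one_iff_integrable.1 (hg.mono_exponent hp1), ?_⟩
  exact tendsto_integral_of_L1' g hgm
    (Eventually.of_forall fun n => memLp_one_iff_integrable.1 (hfi n)) hL1

namespace IsHardy

variable {p : ℝ} {K : NNReal} {F : ℂ → ℂ}

/-- Fatou's theorem for `H^p`, `p > 1`: vertical boundary limits exist almost everywhere. The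
primitive of `F` has locally bounded variation on the real line, hence is differentiable almost
everywhere there, and `F` tends to its derivative. -/
theorem ae_exists_tendsto (hF : IsHardy p K F) (hp : 1 < p) :
    ∀ᵐ x : ℝ, ∃ L : ℂ, Tendsto (fun ε : ℝ => F (x + ε * Complex.I)) (𝓝[>] 0) (𝓝 L) := by
  obtain ⟨C, hC0, hC⟩ := hF.exists_norm_le hp
  obtain ⟨G, hGc, hG, A, hA0, hA⟩ :=
    exists_primitive_continuousOn hp hC0 hF.differentiableOn hC
  have hα : 0 < 1 - 1 / p := by
    rw [sub_pos, div_lt_one (by linarith)]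
    exact hp
  have hbv : LocallyBoundedVariationOn (fun x : ℝ => G x) Set.univ := by
    intro a b _ _
    rw [Set.univ_inter]
    have hlim : ∀ x ∈ Set.Icc a b, Tendsto
        (fun n : ℕ => G (x + ((1 / ((n : ℝ) + 1) : ℝ) : ℂ) * Complex.I)) atTop (𝓝 (G x)) := by
      intro x _
      have h1 : Tendsto (fun ε : ℝ => (x : ℂ) + ε * Complex.I) (𝓝[>] 0)
          (𝓝[{z | 0 ≤ z.im}] (x : ℂ)) := by
        refine tendsto_nhdsWithin_iff.2 ⟨?_, ?_⟩
        · exact (Continuous.tendsto' (by fun_prop) _ _ (by simp)).mono_left nhdsWithin_le_nhds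
        · filter_upwards [eventually_mem_nhdsWithin] with ε hε
          simpa using le_of_lt hε
      exact ((hGc x (by simp)).tendsto.comp h1).comp (tendsto_div_add_one_nhdsGT one_pos)
    have hle : eVariationOn (fun x : ℝ => G x) (Set.Icc a b) ≤
        K * volume (Set.Icc a b) ^ (1 - 1 / p) := by
      by_contra! hlt
      obtain ⟨n, hn⟩ := (eVariationOn.lowerSemicontinuous_aux hlim hlt).exists
      have hn0 : (0 : ℝ) < 1 / ((n : ℝ) + 1) := by positivity
      refine hn.not_ge ((eVariationOn_Icc_le_lintegral (fun x => ?_)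
        (hF.continuous_line hn0) a b).trans (hF.setLIntegral_le hp hn0 _))
      have h1 := hG ((x : ℂ) + ((1 / ((n : ℝ) + 1) : ℝ) : ℂ) * Complex.I) (by
        rw [Complex.add_im, Complex.im_ofReal_mul]
        simpa using hn0)
      exact (h1.comp_add_const (x : ℂ) _).comp_ofReal
    refine (hle.trans_lt ?_).ne
    rw [Real.volume_Icc]
    finiteness
  filter_upwards [hbv.ae_differentiableAt] with x hx
  exact ⟨_, tendsto_vertical_of_hasDerivAt hA0 hGc hG hA hx.hasDerivAt⟩

end IsHardy

/-! ### Integrals over large squares -/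

/-- The integral of `φ` over the boundary of the square `[-R, R] × [-R, R]`, counterclockwise. -/
noncomputable def squareIntegral (R : ℝ) (φ : ℂ → ℂ) : ℂ :=
  (∫ x in -R..R, φ (x + ((-R : ℝ) : ℂ) * Complex.I)) - (∫ x in -R..R, φ (x + (R : ℂ) * Complex.I)) +
    Complex.I * (∫ y in -R..R, φ ((R : ℂ) + y * Complex.I)) -
    Complex.I * ∫ y in -R..R, φ (((-R : ℝ) : ℂ) + y * Complex.I)

theorem le_norm_add_mul_I {R x y : ℝ} (h : R ≤ |x| ∨ R ≤ |y|) : R ≤ ‖(x : ℂ) + y * Complex.I‖ := by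
  rcases h with h | h
  · exact h.trans (by simpa using Complex.abs_re_le_norm ((x : ℂ) + y * Complex.I))
  · exact h.trans (by simpa using Complex.abs_im_le_norm ((x : ℂ) + y * Complex.I))

theorem continuous_horizontal_side {R c : ℝ} {φ : ℂ → ℂ} (hφ : ContinuousOn φ {ζ | R ≤ ‖ζ‖})
    (hc : R ≤ |c|) : Continuous fun x : ℝ => φ (x + (c : ℂ) * Complex.I) :=
  hφ.comp_continuous (by fun_prop) fun _ => le_norm_add_mul_I (Or.inr hc)

theorem continuous_vertical_side {R c : ℝ} {φ : ℂ → ℂ} (hφ : ContinuousOn φ {ζ | R ≤ ‖ζ‖})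
    (hc : R ≤ |c|) : Continuous fun y : ℝ => φ ((c : ℂ) + y * Complex.I) :=
  hφ.comp_continuous (by fun_prop) fun _ => le_norm_add_mul_I (Or.inl hc)

theorem squareIntegral_sub {R : ℝ} {φ ψ : ℂ → ℂ} (hφ : ContinuousOn φ {ζ | R ≤ ‖ζ‖})
    (hψ : ContinuousOn ψ {ζ | R ≤ ‖ζ‖}) :
    squareIntegral R (fun ζ => φ ζ - ψ ζ) = squareIntegral R φ - squareIntegral R ψ := by
  have h1 : R ≤ |R| := le_abs_self R
  have h2 : R ≤ |-R| := by rwa [abs_neg]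
  unfold squareIntegral
  rw [intervalIntegral.integral_sub ((continuous_horizontal_side hφ h2).intervalIntegrable _ _)
      ((continuous_horizontal_side hψ h2).intervalIntegrable _ _),
    intervalIntegral.integral_sub ((continuous_horizontal_side hφ h1).intervalIntegrable _ _)
      ((continuous_horizontal_side hψ h1).intervalIntegrable _ _),
    intervalIntegral.integral_sub ((continuous_vertical_side hφ h1).intervalIntegrable _ _)
      ((continuous_vertical_side hψ h1).intervalIntegrable _ _),
    intervalIntegral.integral_sub ((continuous_vertical_side hφ h2).intervalIntegrable _ _)
      ((continuous_vertical_side hψ h2).intervalIntegrable _ _)]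
  ring

theorem squareIntegral_const_mul (R : ℝ) (c : ℂ) (φ : ℂ → ℂ) :
    squareIntegral R (fun ζ => c * φ ζ) = c * squareIntegral R φ := by
  simp only [squareIntegral, intervalIntegral.integral_const_mul]
  ring

theorem squareIntegral_congr {R : ℝ} {φ ψ : ℂ → ℂ} (h : ∀ ζ : ℂ, R ≤ ‖ζ‖ → φ ζ = ψ ζ) :
    squareIntegral R φ = squareIntegral R ψ := by
  have h1 : R ≤ |R| := le_abs_self R
  have h2 : R ≤ |-R| := by rwa [abs_neg]
  unfold squareIntegral
  simp only [fun x : ℝ => h _ (le_norm_add_mul_I (x := x) (Or.inr h1)),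
    fun x : ℝ => h _ (le_norm_add_mul_I (x := x) (Or.inr h2)),
    fun y : ℝ => h _ (le_norm_add_mul_I (y := y) (Or.inl h1)),
    fun y : ℝ => h _ (le_norm_add_mul_I (y := y) (Or.inl h2))]

theorem norm_squareIntegral_le_sum {R : ℝ} {φ : ℂ → ℂ} {a b : ℝ}
    (hh : ∀ c : ℝ, |c| = R → ‖∫ x in -R..R, φ (x + (c : ℂ) * Complex.I)‖ ≤ a)
    (hv : ∀ c : ℝ, |c| = R → ‖∫ y in -R..R, φ ((c : ℂ) + y * Complex.I)‖ ≤ b) (hR : 0 ≤ R) :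
    ‖squareIntegral R φ‖ ≤ 2 * a + 2 * b := by
  have h1 : |R| = R := abs_of_nonneg hR
  have h2 : |-R| = R := by rwa [abs_neg]
  unfold squareIntegral
  refine (norm_sub_le _ _).trans ?_
  refine (add_le_add_left ((norm_add_le _ _).trans
    (add_le_add_left (norm_sub_le _ _) _)) _).trans ?_
  simp only [norm_mul, Complex.norm_I, one_mul]
  linarith [hh R h1, hh (-R) h2, hv R h1, hv (-R) h2]

theorem norm_squareIntegral_le {R M : ℝ} {φ : ℂ → ℂ} (hR : 0 ≤ R)
    (h : ∀ ζ : ℂ, R ≤ ‖ζ‖ → ‖φ ζ‖ ≤ M) : ‖squareIntegral R φ‖ ≤ 8 * R * M := by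
  have key : ∀ {u : ℝ → ℂ}, (∀ x, ‖u x‖ ≤ M) → ‖∫ x in -R..R, u x‖ ≤ M * (2 * R) := by
    intro u hu
    refine (intervalIntegral.norm_integral_le_of_norm_le_const fun x _ => hu x).trans_eq ?_
    rw [abs_of_nonneg (by linarith)]
    ring
  refine (norm_squareIntegral_le_sum (a := M * (2 * R)) (b := M * (2 * R))
    (fun c hc => key fun x => h _ (le_norm_add_mul_I (Or.inr hc.ge)))
    (fun c hc => key fun x => h _ (le_norm_add_mul_I (Or.inl hc.ge))) hR).trans_eq ?_
  ring

theorem squareIntegral_inv {R : ℝ} (hR : 0 < R) :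
    squareIntegral R (fun ζ => ζ⁻¹) = 2 * Real.pi * Complex.I := by
  have hatan : ∫ x in -R..R, (R ^ 2 + x ^ 2)⁻¹ = R⁻¹ * (Real.pi / 2) := by
    rw [integral_inv_sq_add_sq hR.ne', neg_div, div_self hR.ne', Real.arctan_neg, Real.arctan_one]
    ring
  have hc : ContinuousOn (fun ζ : ℂ => ζ⁻¹) {ζ | R ≤ ‖ζ‖} :=
    continuousOn_id.inv₀ fun ζ hζ => norm_pos_iff.1 (hR.trans_le hζ)
  have h1 : R ≤ |R| := le_abs_self R
  have h2 : R ≤ |-R| := by rwa [abs_neg]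
  have hR' : (R : ℂ) ≠ 0 := by exact_mod_cast hR.ne'
  have hne : ∀ x y : ℝ, (R ≤ |x| ∨ R ≤ |y|) → (x : ℂ) + y * Complex.I ≠ 0 := fun x y h =>
    norm_pos_iff.1 (hR.trans_le (le_norm_add_mul_I h))
  have hpos : ∀ x : ℝ, ((R : ℂ) ^ 2 + (x : ℂ) ^ 2) ≠ 0 := fun x => by
    have : 0 < R ^ 2 + x ^ 2 := by positivity
    exact_mod_cast this.ne'
  have e1 : (∫ x in -R..R, ((x : ℂ) + ((-R : ℝ) : ℂ) * Complex.I)⁻¹) -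
      (∫ x in -R..R, ((x : ℂ) + (R : ℂ) * Complex.I)⁻¹) = Complex.I * Real.pi := by
    rw [← intervalIntegral.integral_sub ((continuous_horizontal_side hc h2).intervalIntegrable _ _)
      ((continuous_horizontal_side hc h1).intervalIntegrable _ _)]
    have : ∀ x : ℝ, ((x : ℂ) + ((-R : ℝ) : ℂ) * Complex.I)⁻¹ - ((x : ℂ) + (R : ℂ) * Complex.I)⁻¹ =
        2 * Complex.I * R * ((R ^ 2 + x ^ 2)⁻¹ : ℝ) := by
      intro x
      have a1 := hne x (-R) (Or.inr h2)
      have a2 := hne x R (Or.inr h1)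
      have a3 := hpos x
      push_cast at a1 ⊢
      rw [inv_sub_inv a1 a2, ← div_eq_mul_inv, div_eq_div_iff (mul_ne_zero a1 a2) a3]
      linear_combination (2 * Complex.I * R ^ 3) * Complex.I_sq
    simp_rw [this]
    rw [intervalIntegral.integral_const_mul, intervalIntegral.integral_ofReal, hatan]
    push_cast
    field_simp
  have e2 : (∫ y in -R..R, ((R : ℂ) + (y : ℂ) * Complex.I)⁻¹) -
      (∫ y in -R..R, (((-R : ℝ) : ℂ) + (y : ℂ) * Complex.I)⁻¹) = Real.pi := by
    rw [← intervalIntegral.integral_sub ((continuous_vertical_side hc h1).intervalIntegrable _ _)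
      ((continuous_vertical_side hc h2).intervalIntegrable _ _)]
    have : ∀ y : ℝ, ((R : ℂ) + (y : ℂ) * Complex.I)⁻¹ - (((-R : ℝ) : ℂ) + (y : ℂ) * Complex.I)⁻¹ =
        -(2 * R) * ((-1) * ((R ^ 2 + y ^ 2)⁻¹ : ℝ)) := by
      intro y
      have a1 := hne R y (Or.inl h1)
      have a2 := hne (-R) y (Or.inl h2)
      have a3 := hpos y
      push_cast at a2 ⊢
      rw [inv_sub_inv a1 a2, neg_one_mul, mul_neg, neg_mul, neg_neg, ← div_eq_mul_inv,
        div_eq_div_iff (mul_ne_zero a1 a2) a3]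
      linear_combination (-2 * R * y ^ 2) * Complex.I_sq
    simp_rw [this]
    rw [intervalIntegral.integral_const_mul, intervalIntegral.integral_const_mul,
      intervalIntegral.integral_ofReal, hatan]
    push_cast
    field_simp
  unfold squareIntegral
  linear_combination e1 + Complex.I * e2

/-- The winding number of a large square around `z`, in the limit. -/
theorem tendsto_squareIntegral_inv_sub (z : ℂ) :
    Tendsto (fun R : ℝ => squareIntegral R fun ζ => (ζ - z)⁻¹) atTop
      (𝓝 (2 * Real.pi * Complex.I)) := by
  rw [tendsto_iff_norm_sub_tendsto_zero]
  have hlim : Tendsto (fun R : ℝ => 16 * ‖z‖ / R) atTop (𝓝 0) :=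
    tendsto_const_nhds.div_atTop tendsto_id
  refine squeeze_zero' (Eventually.of_forall fun _ => norm_nonneg _) ?_ hlim
  filter_upwards [eventually_gt_atTop 0, eventually_ge_atTop (2 * ‖z‖),
    eventually_gt_atTop ‖z‖] with R hR hRz hRz'
  have hne : ∀ ζ ∈ {ζ : ℂ | R ≤ ‖ζ‖}, ζ - z ≠ 0 := fun ζ hζ h => by
    rw [sub_eq_zero.1 h] at hζ
    exact (lt_of_lt_of_le hRz' hζ).false
  have hne0 : ∀ ζ ∈ {ζ : ℂ | R ≤ ‖ζ‖}, ζ ≠ 0 := fun ζ hζ => norm_pos_iff.1 (hR.trans_le hζ)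
  rw [← squareIntegral_inv hR, ← squareIntegral_sub
    (φ := fun ζ => (ζ - z)⁻¹) (ψ := fun ζ => ζ⁻¹) (ContinuousOn.inv₀ (by fun_prop) hne)
    (ContinuousOn.inv₀ continuousOn_id hne0)]
  refine (norm_squareIntegral_le (M := ‖z‖ / (R / 2 * R)) hR.le fun ζ hζ => ?_).trans_eq ?_
  · have h1 : R / 2 ≤ ‖ζ - z‖ := by
      have h3 : R ≤ ‖ζ‖ := hζ
      linarith [norm_sub_norm_le ζ z]
    rw [inv_sub_inv (hne ζ hζ) (hne0 ζ hζ), norm_div, norm_mul]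
    have : ζ - (ζ - z) = z := by ring
    rw [this]
    gcongr
  · field_simp
    ring

/-- The boundary integral of `F(ζ) / (ζ - z)` over large squares vanishes in the limit when
`F = O(|Im ζ|^{-1/p})`. -/
theorem tendsto_squareIntegral_div_sub {F : ℂ → ℂ} {C p : ℝ} (hp : 1 < p) (hC0 : 0 ≤ C)
    (hC : ∀ ζ : ℂ, ζ.im ≠ 0 → ‖F ζ‖ ≤ C * |ζ.im| ^ (-(1 / p))) (z : ℂ) :
    Tendsto (fun R : ℝ => squareIntegral R fun ζ => F ζ / (ζ - z)) atTop (𝓝 0) := by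
  have hα : 0 < 1 - 1 / p := by
    rw [sub_pos, div_lt_one (by linarith)]
    exact hp
  have hlim : Tendsto (fun R : ℝ => (8 * C + 8 * C / (1 - 1 / p)) * R ^ (-(1 / p))) atTop (𝓝 0) := by
    simpa using (tendsto_rpow_neg_atTop (y := 1 / p) (by positivity)).const_mul
      (8 * C + 8 * C / (1 - 1 / p))
  refine squeeze_zero_norm' ?_ hlim
  filter_upwards [eventually_gt_atTop 0, eventually_ge_atTop (2 * ‖z‖)] with R hR hRz
  have hden : ∀ ζ : ℂ, R ≤ ‖ζ‖ → R / 2 ≤ ‖ζ - z‖ := fun ζ hζ => by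
    linarith [norm_sub_norm_le ζ z]
  have hpt : ∀ ζ : ℂ, R ≤ ‖ζ‖ → ζ.im ≠ 0 →
      ‖F ζ / (ζ - z)‖ ≤ C * |ζ.im| ^ (-(1 / p)) / (R / 2) := by
    intro ζ hζ h0
    rw [norm_div]
    have := hden ζ hζ
    have := hC ζ h0
    gcongr
  have hpow : R ^ (1 - 1 / p) = R * R ^ (-(1 / p)) := by
    rw [sub_eq_add_neg, Real.rpow_add hR, Real.rpow_one]
  -- One half of a vertical side.
  have hhalf : ∀ u : ℝ → ℂ, (∀ y : ℝ, 0 < y → ‖u y‖ ≤ C * y ^ (-(1 / p)) / (R / 2)) →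
      ‖∫ y in (0 : ℝ)..R, u y‖ ≤ 2 * C / (1 - 1 / p) * R ^ (-(1 / p)) := by
    intro u hu
    have hexp : -1 < -(1 / p) := by linarith
    have hint : IntervalIntegrable (fun y : ℝ => C * y ^ (-(1 / p)) / (R / 2)) volume 0 R :=
      ((intervalIntegral.intervalIntegrable_rpow' hexp).const_mul C).div_const _
    refine (intervalIntegral.norm_integral_le_of_norm_le hR.le
      (Eventually.of_forall fun y hy => hu y hy.1) hint).trans_eq ?_
    rw [intervalIntegral.integral_div, intervalIntegral.integral_const_mul,
      integral_rpow (Or.inl hexp), neg_add_eq_sub, Real.zero_rpow hα.ne', hpow]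
    field_simp
    ring
  refine (norm_squareIntegral_le_sum (a := 4 * C * R ^ (-(1 / p)))
    (b := 4 * C / (1 - 1 / p) * R ^ (-(1 / p))) (fun c hc => ?_) (fun c hc => ?_)
    hR.le).trans_eq (by ring)
  · refine (intervalIntegral.norm_integral_le_of_norm_le_const (C := C * R ^ (-(1 / p)) / (R / 2))
      fun x _ => ?_).trans_eq ?_
    · have hc0 : c ≠ 0 := by
        rintro rfl
        rw [abs_zero] at hc
        exact hR.ne hc
      have h := hpt ((x : ℂ) + (c : ℂ) * Complex.I) (le_norm_add_mul_I (Or.inr hc.ge))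
        (by simpa using hc0)
      simpa [hc] using h
    · rw [sub_neg_eq_add, abs_of_pos (by linarith)]
      field_simp
      ring
  · set u : ℝ → ℂ := fun y => F ((c : ℂ) + y * Complex.I) / ((c : ℂ) + y * Complex.I - z) with hu
    have hub : ∀ y : ℝ, y ≠ 0 → ‖u y‖ ≤ C * |y| ^ (-(1 / p)) / (R / 2) := by
      intro y hy
      simpa [hu] using hpt ((c : ℂ) + y * Complex.I) (le_norm_add_mul_I (Or.inl hc.ge))
        (by simpa using hy)
    have hpos := hhalf u fun y hy => by simpa [abs_of_pos hy] using hub y hy.ne'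
    have hneg := hhalf (fun y => u (-y)) fun y hy => by
      simpa [abs_of_pos hy] using hub (-y) (neg_ne_zero.2 hy.ne')
    rw [intervalIntegral.integral_comp_neg (fun y => u y), neg_zero] at hneg
    have hnn : 0 ≤ 4 * C / (1 - 1 / p) * R ^ (-(1 / p)) := by positivity
    by_cases hi : IntervalIntegrable u volume (-R) R
    · have h0 : (0 : ℝ) ∈ Set.uIcc (-R) R := by
        rw [Set.uIcc_of_le (by linarith)]
        constructor <;> linarith
      rw [← intervalIntegral.integral_add_adjacent_intervals
        (hi.mono_set (Set.uIcc_subset_uIcc_left h0)) (hi.mono_set (Set.uIcc_subset_uIcc_right h0))]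
      refine (norm_add_le _ _).trans ((add_le_add hneg hpos).trans_eq ?_)
      ring
    -- Without integrability the side contributes the junk value `0`, and the bound is trivial.
    · rw [intervalIntegral.integral_undef hi, norm_zero]
      exact hnn

/-! ### Cauchy's theorem on a cut square -/

/-- Passage to the boundary in the difference quotient kernel. The horizontal lines of height `τ n`
stay away from the height of `z`, so that the kernel is bounded along the sequence. -/
theorem tendsto_integral_kernel {F : ℂ → ℂ} {f : ℝ → ℂ} {τ : ℕ → ℝ} {p : ℝ} {K : NNReal} {z : ℂ}
    (hp : 1 < p) (hτ : Tendsto τ atTop (𝓝 0)) (hτz : ∀ n, |τ n| ≤ |z.im| / 2) (hz : z.im ≠ 0)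
    (hcont : ∀ n, Continuous fun x : ℝ => F (x + τ n * Complex.I))
    (hb : ∀ n, eLpNorm (fun x : ℝ => F (x + τ n * Complex.I)) (ENNReal.ofReal p) volume ≤ K)
    (hlim : ∀ᵐ x : ℝ, Tendsto (fun n => F (x + τ n * Complex.I)) atTop (𝓝 (f x))) (w : ℂ) {R : ℝ}
    (hR : 0 ≤ R) :
    IntervalIntegrable (fun x : ℝ => (f x - w) / (x - z)) volume (-R) R ∧
      Tendsto (fun n => ∫ x in -R..R,
        (F (x + τ n * Complex.I) - w) / (x + τ n * Complex.I - z)) atTop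
        (𝓝 (∫ x in -R..R, (f x - w) / (x - z))) := by
  have hz0 : 0 < |z.im| / 2 := by positivity
  have hden : ∀ (n : ℕ) (x : ℝ), |z.im| / 2 ≤ ‖(x : ℂ) + τ n * Complex.I - z‖ := by
    intro n x
    refine le_trans ?_ (Complex.abs_im_le_norm _)
    have h1 : ((x : ℂ) + τ n * Complex.I - z).im = τ n - z.im := by simp
    rw [h1, abs_sub_comm]
    linarith [abs_sub_abs_le_abs_sub z.im (τ n), hτz n]
  have hden0 : ∀ (n : ℕ) (x : ℝ), (x : ℂ) + τ n * Complex.I - z ≠ 0 := fun n x =>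
    norm_pos_iff.1 (hz0.trans_le (hden n x))
  have hx0 : ∀ x : ℝ, (x : ℂ) - z ≠ 0 := by
    intro x h
    have := congrArg Complex.im h
    simp at this
    exact hz this
  set c : NNReal := (|z.im| / 2).toNNReal⁻¹ with hc
  have hfb : ∀ n, eLpNorm (fun x : ℝ => (F (x + τ n * Complex.I) - w) /
      (x + τ n * Complex.I - z)) (ENNReal.ofReal p) (volume.restrict (Set.Ioc (-R) R)) ≤
      c * (K + eLpNorm (fun _ : ℝ => w) (ENNReal.ofReal p)
        (volume.restrict (Set.Ioc (-R) R))) := by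
    intro n
    refine (eLpNorm_le_nnreal_smul_eLpNorm_of_ae_le_mul
      (g := fun x : ℝ => F (x + τ n * Complex.I) - w) (c := c) (Eventually.of_forall fun x => ?_)
      _).trans ?_
    · rw [← NNReal.coe_le_coe]
      push_cast
      rw [norm_div, hc, NNReal.coe_inv, Real.coe_toNNReal _ hz0.le, div_eq_inv_mul]
      gcongr
      exact hden n x
    · rw [ENNReal.smul_def, smul_eq_mul]
      gcongr
      refine (eLpNorm_sub_le (hcont n).aestronglyMeasurable aestronglyMeasurable_const
        (by simpa using hp.le)).trans ?_
      gcongr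
      exact (eLpNorm_mono_measure _ Measure.restrict_le_self).trans (hb n)
  have hfin : c * (K + eLpNorm (fun _ : ℝ => w) (ENNReal.ofReal p)
      (volume.restrict (Set.Ioc (-R) R))) ≠ ⊤ := by
    have : eLpNorm (fun _ : ℝ => w) (ENNReal.ofReal p) (volume.restrict (Set.Ioc (-R) R)) ≠ ⊤ :=
      (memLp_const w).eLpNorm_ne_top
    finiteness
  have hlim' : ∀ᵐ x : ℝ ∂(volume.restrict (Set.Ioc (-R) R)),
      Tendsto (fun n => (F (x + τ n * Complex.I) - w) / (x + τ n * Complex.I - z)) atTop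
        (𝓝 ((f x - w) / (x - z))) := by
    filter_upwards [ae_restrict_of_ae hlim] with x hx
    refine (hx.sub_const w).div ?_ (hx0 x)
    have h1 : Tendsto (fun n => ((τ n : ℝ) : ℂ)) atTop (𝓝 0) :=
      (Complex.continuous_ofReal.tendsto' 0 0 Complex.ofReal_zero).comp hτ
    simpa using ((h1.mul_const Complex.I).const_add (x : ℂ)).sub_const z
  have h := tendsto_integral_of_eLpNorm_le hp hfin (fun n =>
    (((hcont n).sub continuous_const).div (by fun_prop) (hden0 n)).aestronglyMeasurable) hfb hlim'
  have hle : -R ≤ R := by linarith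
  refine ⟨(intervalIntegrable_iff_integrableOn_Ioc_of_le hle).2 h.1, ?_⟩
  simp only [intervalIntegral.integral_of_le hle]
  exact h.2

/-- Cauchy's theorem on a large square cut along the real line. -/
theorem integral_jump_add_squareIntegral_eq_zero {h : ℂ → ℂ} {up lo : ℂ} {R : ℝ} (hR : 0 < R)
    {E : Set ℝ} (hE : ∀ x ∈ E, |x| < R)
    (hd : DifferentiableOn ℂ h ((fun x : ℝ => (x : ℂ)) '' E)ᶜ) {τ : ℕ → ℝ}
    (hτ0 : ∀ n, 0 < τ n) (hτ : Tendsto τ atTop (𝓝 0))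
    (hup : Tendsto (fun n => ∫ x in -R..R, h (x + τ n * Complex.I)) atTop (𝓝 up))
    (hlo : Tendsto (fun n => ∫ x in -R..R, h (x + ((-τ n : ℝ) : ℂ) * Complex.I)) atTop (𝓝 lo)) :
    up - lo + squareIntegral R h = 0 := by
  have hmem : ∀ ζ : ℂ, ζ.im ≠ 0 → ζ ∈ ((fun x : ℝ => (x : ℂ)) '' E)ᶜ := by
    rintro _ hζ ⟨x, _, rfl⟩
    simp at hζ
  have hmem' : ∀ ζ : ℂ, R ≤ ‖ζ‖ → ζ ∈ ((fun x : ℝ => (x : ℂ)) '' E)ᶜ := by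
    rintro _ hζ ⟨x, hx, rfl⟩
    have := hE x hx
    simp at hζ
    linarith
  have hc : ContinuousOn h {ζ | R ≤ ‖ζ‖} := hd.continuousOn.mono hmem'
  have hside : ∀ c : ℝ, R ≤ |c| → Continuous fun y : ℝ => h ((c : ℂ) + y * Complex.I) :=
    fun c hcR => continuous_vertical_side hc hcR
  have h1 : R ≤ |R| := le_abs_self R
  have h2 : R ≤ |-R| := by rwa [abs_neg]
  have hupper : ∀ n, τ n ≤ R →
      (∫ x in -R..R, h (x + τ n * Complex.I)) - (∫ x in -R..R, h (x + (R : ℂ) * Complex.I)) +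
      Complex.I * (∫ y in (τ n)..R, h ((R : ℂ) + y * Complex.I)) -
      Complex.I * (∫ y in (τ n)..R, h (((-R : ℝ) : ℂ) + y * Complex.I)) = 0 := by
    intro n hn
    have := Complex.integral_boundary_rect_eq_zero_of_differentiableOn h ⟨-R, τ n⟩ ⟨R, R⟩ ?_
    · simpa using this
    · refine hd.mono fun ζ hζ => hmem ζ ?_
      have h3 := hζ.2
      simp only [Set.mem_preimage, Set.uIcc_of_le hn] at h3
      exact ((hτ0 n).trans_le h3.1).ne'
  have hlower : ∀ n, τ n ≤ R →
      (∫ x in -R..R, h (x + ((-R : ℝ) : ℂ) * Complex.I)) -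
      (∫ x in -R..R, h (x + ((-τ n : ℝ) : ℂ) * Complex.I)) +
      Complex.I * (∫ y in -R..(-τ n), h ((R : ℂ) + y * Complex.I)) -
      Complex.I * (∫ y in -R..(-τ n), h (((-R : ℝ) : ℂ) + y * Complex.I)) = 0 := by
    intro n hn
    have := Complex.integral_boundary_rect_eq_zero_of_differentiableOn h ⟨-R, -R⟩ ⟨R, -τ n⟩ ?_
    · simpa using this
    · refine hd.mono fun ζ hζ => hmem ζ ?_
      have h3 := hζ.2
      simp only [Set.mem_preimage, Set.uIcc_of_le (neg_le_neg hn)] at h3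
      exact (h3.2.trans_lt (neg_lt_zero.2 (hτ0 n))).ne
  -- The parts of the vertical sides outside the strip of width `2 τ n` exhaust the sides.
  have hvert : ∀ c : ℝ, R ≤ |c| → Tendsto (fun n =>
      (∫ y in (τ n)..R, h ((c : ℂ) + y * Complex.I)) +
      ∫ y in -R..(-τ n), h ((c : ℂ) + y * Complex.I)) atTop
      (𝓝 (∫ y in -R..R, h ((c : ℂ) + y * Complex.I))) := by
    intro c hcR
    have hi : ∀ a b : ℝ, IntervalIntegrable (fun y : ℝ => h ((c : ℂ) + y * Complex.I)) volume a b :=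
      fun a b => (hside c hcR).intervalIntegrable a b
    have hP := intervalIntegral.continuous_primitive hi 0
    have e : ∀ n, (∫ y in (τ n)..R, h ((c : ℂ) + y * Complex.I)) +
        (∫ y in -R..(-τ n), h ((c : ℂ) + y * Complex.I)) =
        (∫ y in -R..R, h ((c : ℂ) + y * Complex.I)) -
          (∫ y in (0 : ℝ)..(τ n), h ((c : ℂ) + y * Complex.I)) +
          ∫ y in (0 : ℝ)..(-τ n), h ((c : ℂ) + y * Complex.I) := by
      intro n
      rw [← intervalIntegral.integral_interval_sub_left (hi 0 R) (hi 0 (τ n)),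
        ← intervalIntegral.integral_interval_sub_left (hi 0 (-τ n)) (hi 0 (-R)),
        ← intervalIntegral.integral_interval_sub_left (hi 0 R) (hi 0 (-R))]
      ring
    simp_rw [e]
    have t1 := (hP.tendsto 0).comp hτ
    have t2 := (hP.tendsto' (-0) _ rfl).comp hτ.neg
    have t3 := (tendsto_const_nhds (x := ∫ y in -R..R, h ((c : ℂ) + y * Complex.I))).sub t1 |>.add t2
    simpa using t3
  have hsum : Tendsto (fun n : ℕ =>
      ((∫ x in -R..R, h (x + τ n * Complex.I)) -
      (∫ x in -R..R, h (x + ((-τ n : ℝ) : ℂ) * Complex.I))) +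
      ((∫ x in -R..R, h (x + ((-R : ℝ) : ℂ) * Complex.I)) -
      (∫ x in -R..R, h (x + (R : ℂ) * Complex.I)) +
      Complex.I * ((∫ y in (τ n)..R, h ((R : ℂ) + y * Complex.I)) +
        ∫ y in -R..(-τ n), h ((R : ℂ) + y * Complex.I)) -
      Complex.I * ((∫ y in (τ n)..R, h (((-R : ℝ) : ℂ) + y * Complex.I)) +
        ∫ y in -R..(-τ n), h (((-R : ℝ) : ℂ) + y * Complex.I)))) atTop
      (𝓝 (up - lo + squareIntegral R h)) :=
    (hup.sub hlo).add (((tendsto_const_nhds).add ((hvert R h1).const_mul Complex.I)).sub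
      ((hvert (-R) h2).const_mul Complex.I))
  refine tendsto_nhds_unique hsum (tendsto_const_nhds.congr' ?_)
  filter_upwards [hτ.eventually (ge_mem_nhds hR)] with n hn
  linear_combination -(hupper n hn) - hlower n hn

/-! ### Cauchy representation by the jump -/

/-- A function holomorphic off a set `E` of real points which belongs to the Hardy class `H^p` of
both half-planes. -/
structure IsCutHardy (p : ℝ) (K : NNReal) (E : Set ℝ) (F : ℂ → ℂ) : Prop where
  differentiableOn : DifferentiableOn ℂ F ((fun x : ℝ => (x : ℂ)) '' E)ᶜ
  eLpNorm_upper_le : ∀ ρ : ℝ, 0 < ρ →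
    eLpNorm (fun x : ℝ => F (x + ρ * Complex.I)) (ENNReal.ofReal p) volume ≤ K
  eLpNorm_lower_le : ∀ ρ : ℝ, 0 < ρ →
    eLpNorm (fun x : ℝ => F (x - ρ * Complex.I)) (ENNReal.ofReal p) volume ≤ K

theorem mem_compl_image_ofReal {E : Set ℝ} {ζ : ℂ} (hζ : ζ.im ≠ 0) :
    ζ ∈ ((fun x : ℝ => (x : ℂ)) '' E)ᶜ := by
  rintro ⟨x, _, rfl⟩
  simp at hζ

theorem isOpen_compl_image_ofReal {E : Set ℝ} (hE : IsCompact E) :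
    IsOpen ((fun x : ℝ => (x : ℂ)) '' E)ᶜ :=
  (hE.image Complex.continuous_ofReal).isClosed.isOpen_compl

namespace IsCutHardy

variable {p : ℝ} {K : NNReal} {E : Set ℝ} {F : ℂ → ℂ}

theorem isHardy_upper (hF : IsCutHardy p K E F) : IsHardy p K F :=
  ⟨hF.differentiableOn.mono fun _ hz => mem_compl_image_ofReal (ne_of_gt hz), hF.eLpNorm_upper_le⟩

/-- Reflection in the real line exchanges the two half-planes. -/
theorem isHardy_lower (hF : IsCutHardy p K E F) (hE : IsCompact E) :
    IsHardy p K (starRingEnd ℂ ∘ F ∘ starRingEnd ℂ) := by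
  refine ⟨fun z hz => ?_, fun ρ hρ => ?_⟩
  · refine (differentiableAt_conj_conj_iff.2 ?_).differentiableWithinAt
    refine hF.differentiableOn.differentiableAt ((isOpen_compl_image_ofReal hE).mem_nhds ?_)
    refine mem_compl_image_ofReal ?_
    rw [Complex.conj_im]
    exact neg_ne_zero.2 (ne_of_gt hz)
  · refine le_trans (le_of_eq ?_) (hF.eLpNorm_lower_le ρ hρ)
    refine eLpNorm_congr_norm_ae (Eventually.of_forall fun x => ?_)
    simp [sub_eq_add_neg]

theorem ae_exists_upper (hF : IsCutHardy p K E F) (hp : 1 < p) :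
    ∀ᵐ x : ℝ, ∃ L : ℂ, Tendsto (fun ε : ℝ => F (x + ε * Complex.I)) (𝓝[>] 0) (𝓝 L) :=
  hF.isHardy_upper.ae_exists_tendsto hp

theorem ae_exists_lower (hF : IsCutHardy p K E F) (hE : IsCompact E) (hp : 1 < p) :
    ∀ᵐ x : ℝ, ∃ L : ℂ, Tendsto (fun ε : ℝ => F (x - ε * Complex.I)) (𝓝[>] 0) (𝓝 L) := by
  filter_upwards [(hF.isHardy_lower hE).ae_exists_tendsto hp] with x hx
  obtain ⟨L, hL⟩ := hx
  refine ⟨starRingEnd ℂ L, ?_⟩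
  have h := (Complex.continuous_conj.tendsto L).comp hL
  refine h.congr fun ε => ?_
  simp [sub_eq_add_neg]

/-- Off the cuts the boundary values from the two sides agree. -/
theorem tendsto_of_notMem (hF : IsCutHardy p K E F) (hE : IsCompact E) {x : ℝ} (hx : x ∉ E) (s : ℝ) :
    Tendsto (fun ε : ℝ => F (x + s * ε * Complex.I)) (𝓝[>] 0) (𝓝 (F x)) := by
  have hmem : (x : ℂ) ∈ ((fun x : ℝ => (x : ℂ)) '' E)ᶜ := by
    rintro ⟨y, hy, hyx⟩
    exact hx (Complex.ofReal_injective hyx ▸ hy)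
  have hc := (hF.differentiableOn.differentiableAt
    ((isOpen_compl_image_ofReal hE).mem_nhds hmem)).continuousAt
  refine hc.tendsto.comp ?_
  exact (Continuous.tendsto' (by fun_prop) _ _ (by simp)).mono_left nhdsWithin_le_nhds

theorem exists_norm_le (hF : IsCutHardy p K E F) (hE : IsCompact E) (hp : 1 < p) :
    ∃ C : ℝ, 0 ≤ C ∧ ∀ ζ : ℂ, ζ.im ≠ 0 → ‖F ζ‖ ≤ C * |ζ.im| ^ (-(1 / p)) := by
  obtain ⟨C₁, h₁, hC₁⟩ := hF.isHardy_upper.exists_norm_le hp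
  obtain ⟨C₂, h₂, hC₂⟩ := (hF.isHardy_lower hE).exists_norm_le hp
  refine ⟨max C₁ C₂, h₁.trans (le_max_left C₁ C₂), fun ζ hζ => ?_⟩
  rcases lt_or_gt_of_ne hζ with h | h
  · have h3 := hC₂ (starRingEnd ℂ ζ) (by simpa using h)
    simp only [Function.comp_apply, Complex.conj_conj, RCLike.norm_conj, Complex.conj_im] at h3
    rw [abs_of_neg h]
    exact h3.trans (mul_le_mul_of_nonneg_right (le_max_right C₁ C₂)
      (Real.rpow_nonneg (neg_nonneg.2 h.le) _))
  · rw [abs_of_pos h]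
    exact (hC₁ ζ h).trans (mul_le_mul_of_nonneg_right (le_max_left C₁ C₂)
      (Real.rpow_nonneg h.le _))

variable {f₁ f₂ : ℝ → ℂ}

theorem integrableOn_jump (hF : IsCutHardy p K E F) (hE : IsCompact E) (hp : 1 < p)
    (h₁ : ∀ᵐ x : ℝ, Tendsto (fun ε : ℝ => F (x + ε * Complex.I)) (𝓝[>] 0) (𝓝 (f₁ x)))
    (h₂ : ∀ᵐ x : ℝ, Tendsto (fun ε : ℝ => F (x - ε * Complex.I)) (𝓝[>] 0) (𝓝 (f₂ x))) :
    IntegrableOn (fun x => f₁ x - f₂ x) E := by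
  have : IsFiniteMeasure (volume.restrict E) := ⟨by
    rw [Measure.restrict_apply_univ]; exact hE.measure_lt_top⟩
  have hτ := tendsto_div_add_one_nhdsGT one_pos
  have hτ0 : ∀ n : ℕ, (0 : ℝ) < 1 / ((n : ℝ) + 1) := fun n => by positivity
  have hlow : ∀ n : ℕ, Continuous fun x : ℝ => F (x - ((1 / ((n : ℝ) + 1) : ℝ) : ℂ) * Complex.I) :=
    fun n => hF.differentiableOn.continuousOn.comp_continuous (by fun_prop) fun x =>
      mem_compl_image_ofReal (by
        rw [Complex.sub_im, Complex.im_ofReal_mul]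
        simpa using (hτ0 n).ne')
  refine Integrable.sub ?_ ?_
  · exact (tendsto_integral_of_eLpNorm_le hp ENNReal.coe_ne_top
      (fun n => (hF.isHardy_upper.continuous_line (hτ0 n)).aestronglyMeasurable)
      (fun n => (eLpNorm_mono_measure _ Measure.restrict_le_self).trans
        (hF.eLpNorm_upper_le _ (hτ0 n)))
      (ae_restrict_of_ae (h₁.mono fun x hx => hx.comp hτ))).1
  · exact (tendsto_integral_of_eLpNorm_le hp ENNReal.coe_ne_top
      (fun n => (hlow n).aestronglyMeasurable)
      (fun n => (eLpNorm_mono_measure _ Measure.restrict_le_self).trans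
        (hF.eLpNorm_lower_le _ (hτ0 n)))
      (ae_restrict_of_ae (h₂.mono fun x hx => hx.comp hτ))).1

theorem integrableOn_div_sub (hF : IsCutHardy p K E F) (hE : IsCompact E) (hp : 1 < p)
    (h₁ : ∀ᵐ x : ℝ, Tendsto (fun ε : ℝ => F (x + ε * Complex.I)) (𝓝[>] 0) (𝓝 (f₁ x)))
    (h₂ : ∀ᵐ x : ℝ, Tendsto (fun ε : ℝ => F (x - ε * Complex.I)) (𝓝[>] 0) (𝓝 (f₂ x)))
    {z : ℂ} (hz : z ∉ (fun x : ℝ => (x : ℂ)) '' E) :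
    IntegrableOn (fun x => (f₁ x - f₂ x) / (x - z)) E := by
  simp only [div_eq_mul_inv]
  refine (hF.integrableOn_jump hE hp h₁ h₂).mul_continuousOn ?_ hE
  refine ContinuousOn.inv₀ (by fun_prop) fun x hx h => hz ⟨x, hx, ?_⟩
  exact sub_eq_zero.1 h

/-- The Cauchy integral formula on a square containing the cuts. -/
theorem integral_jump_add_squareIntegral (hF : IsCutHardy p K E F) (hE : IsCompact E)
    (hp : 1 < p)
    (h₁ : ∀ᵐ x : ℝ, Tendsto (fun ε : ℝ => F (x + ε * Complex.I)) (𝓝[>] 0) (𝓝 (f₁ x)))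
    (h₂ : ∀ᵐ x : ℝ, Tendsto (fun ε : ℝ => F (x - ε * Complex.I)) (𝓝[>] 0) (𝓝 (f₂ x)))
    {z : ℂ} (hz : z.im ≠ 0) {R : ℝ} (hER : ∀ x ∈ E, |x| < R) (hzR : ‖z‖ < R) :
    (∫ x in E, (f₁ x - f₂ x) / (x - z)) + (squareIntegral R (fun ζ => F ζ / (ζ - z)) -
      F z * squareIntegral R fun ζ => (ζ - z)⁻¹) = 0 := by
  have hR : 0 < R := (norm_nonneg z).trans_lt hzR
  have hz0 : 0 < |z.im| / 2 := by positivity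
  set τ : ℕ → ℝ := fun n => |z.im| / 2 / ((n : ℝ) + 1) with hτdef
  have hτ := tendsto_div_add_one_nhdsGT hz0
  have hτ' : Tendsto τ atTop (𝓝 0) := hτ.mono_right nhdsWithin_le_nhds
  have hτ0 : ∀ n, 0 < τ n := fun n => by positivity
  have hτz : ∀ n, τ n ≤ |z.im| / 2 := fun n =>
    div_le_self hz0.le (by linarith [n.cast_nonneg (α := ℝ)])
  have hnez : ∀ (n : ℕ) (s : ℝ) (x : ℝ), |s| = τ n → (x : ℂ) + s * Complex.I ≠ z := by
    rintro n s x hs rfl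
    have h := hτz n
    rw [← hs] at h
    simp at h hz
    linarith [abs_pos.2 hz]
  -- The two sides of the real line.
  obtain ⟨hi₁, ht₁⟩ := tendsto_integral_kernel (F := F) (f := f₁) (τ := τ) (K := K) hp hτ'
    (fun n => (abs_of_pos (hτ0 n)).trans_le (hτz n)) hz
    (fun n => hF.isHardy_upper.continuous_line (hτ0 n))
    (fun n => hF.eLpNorm_upper_le _ (hτ0 n)) (h₁.mono fun x hx => hx.comp hτ) (F z) hR.le
  have hneg : ∀ (n : ℕ) (x : ℝ), (x : ℂ) + ((-τ n : ℝ) : ℂ) * Complex.I = x - τ n * Complex.I := by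
    intro n x
    push_cast
    ring
  obtain ⟨hi₂, ht₂⟩ := tendsto_integral_kernel (F := F) (f := f₂) (τ := fun n => -τ n) (K := K) hp
    (by simpa using hτ'.neg)
    (fun n => by rw [abs_neg]; exact (abs_of_pos (hτ0 n)).trans_le (hτz n)) hz
    (fun n => hF.differentiableOn.continuousOn.comp_continuous (by fun_prop) fun x =>
      mem_compl_image_ofReal (by
        rw [Complex.add_im, Complex.im_ofReal_mul]
        simpa using (hτ0 n).ne'))
    (fun n => by simpa only [hneg] using hF.eLpNorm_lower_le _ (hτ0 n))
    (h₂.mono fun x hx => by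
      simp only [hneg]
      exact hx.comp hτ) (F z) hR.le
  have hopen := isOpen_compl_image_ofReal hE
  have hslope : ∀ ζ : ℂ, ζ ≠ z → dslope F z ζ = (F ζ - F z) / (ζ - z) := by
    intro ζ hζ
    rw [dslope_of_ne _ hζ, slope_def_field]
  -- The difference quotient is holomorphic off the cuts, at `z` included.
  have key := integral_jump_add_squareIntegral_eq_zero (h := dslope F z) hR hER
    ((Complex.differentiableOn_dslope (hopen.mem_nhds (mem_compl_image_ofReal hz))).2
      hF.differentiableOn) hτ0 hτ'
    (ht₁.congr fun n => intervalIntegral.integral_congr fun x _ =>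
      (hslope _ (hnez n (τ n) x (abs_of_pos (hτ0 n)))).symm)
    (ht₂.congr fun n => intervalIntegral.integral_congr fun x _ =>
      (hslope _ (hnez n (-τ n) x (by rw [abs_neg, abs_of_pos (hτ0 n)]))).symm)
  have hnez' : ∀ ζ : ℂ, R ≤ ‖ζ‖ → ζ - z ≠ 0 := fun ζ hζ h => by
    rw [sub_eq_zero.1 h] at hζ
    exact (hzR.trans_le hζ).false
  have hFc : ContinuousOn F {ζ : ℂ | R ≤ ‖ζ‖} := by
    refine hF.differentiableOn.continuousOn.mono ?_
    rintro _ hζ ⟨x, hx, rfl⟩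
    have := hER x hx
    simp at hζ
    linarith
  have hinv : ContinuousOn (fun ζ : ℂ => (ζ - z)⁻¹) {ζ : ℂ | R ≤ ‖ζ‖} :=
    ContinuousOn.inv₀ (by fun_prop) hnez'
  rw [squareIntegral_congr (ψ := fun ζ => F ζ / (ζ - z) - F z * (ζ - z)⁻¹) fun ζ hζ => by
      rw [hslope ζ (sub_ne_zero.1 (hnez' ζ hζ))]
      ring,
    squareIntegral_sub (φ := fun ζ => F ζ / (ζ - z)) (ψ := fun ζ => F z * (ζ - z)⁻¹)
      (by simp only [div_eq_mul_inv]; exact hFc.mul hinv) (continuousOn_const.mul hinv),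
    squareIntegral_const_mul, ← intervalIntegral.integral_sub hi₁ hi₂] at key
  rw [← key]
  congr 1
  have hle : -R ≤ R := by linarith
  rw [intervalIntegral.integral_of_le hle]
  have hfun : ∀ x : ℝ, (f₁ x - F z) / (x - z) - (f₂ x - F z) / (x - z) =
      (f₁ x - f₂ x) / (x - z) := fun x => by ring
  simp_rw [hfun]
  refine (setIntegral_eq_of_subset_of_ae_sdiff_eq_zero measurableSet_Ioc.nullMeasurableSet
    (fun x hx => ?_) ?_).symm
  · have := abs_lt.1 (hER x hx)
    exact ⟨this.1, this.2.le⟩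
  · filter_upwards [h₁, h₂] with x hx₁ hx₂ hx
    have e₁ := tendsto_nhds_unique hx₁ (by simpa using hF.tendsto_of_notMem hE hx.2 1)
    have e₂ := tendsto_nhds_unique hx₂
      (by simpa [← sub_eq_add_neg] using hF.tendsto_of_notMem hE hx.2 (-1))
    rw [e₁, e₂, sub_self, zero_div]

/-- The Cauchy representation of `F` by its jump, at nonreal points. -/
theorem two_pi_I_mul_eq_integral_of_im_ne_zero (hF : IsCutHardy p K E F) (hE : IsCompact E)
    (hp : 1 < p)
    (h₁ : ∀ᵐ x : ℝ, Tendsto (fun ε : ℝ => F (x + ε * Complex.I)) (𝓝[>] 0) (𝓝 (f₁ x)))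
    (h₂ : ∀ᵐ x : ℝ, Tendsto (fun ε : ℝ => F (x - ε * Complex.I)) (𝓝[>] 0) (𝓝 (f₂ x)))
    {z : ℂ} (hz : z.im ≠ 0) :
    2 * Real.pi * Complex.I * F z = ∫ x in E, (f₁ x - f₂ x) / (x - z) := by
  obtain ⟨C, hC0, hC⟩ := hF.exists_norm_le hE hp
  obtain ⟨A, hA⟩ := hE.isBounded.exists_norm_le
  have hlim := ((tendsto_squareIntegral_div_sub hp hC0 hC z).sub
    ((tendsto_squareIntegral_inv_sub z).const_mul (F z))).const_add
      (∫ x in E, (f₁ x - f₂ x) / (x - z))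
  have hzero := tendsto_nhds_unique hlim (tendsto_const_nhds.congr' (by
    filter_upwards [eventually_gt_atTop A, eventually_gt_atTop ‖z‖] with R hRA hRz
    exact (hF.integral_jump_add_squareIntegral hE hp h₁ h₂ hz
      (fun x hx => (hA x hx).trans_lt hRA) hRz).symm))
  linear_combination -hzero

/-- The Cauchy representation of `F` by its jump. -/
theorem two_pi_I_mul_eq_integral (hF : IsCutHardy p K E F) (hE : IsCompact E) (hp : 1 < p)
    (h₁ : ∀ᵐ x : ℝ, Tendsto (fun ε : ℝ => F (x + ε * Complex.I)) (𝓝[>] 0) (𝓝 (f₁ x)))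
    (h₂ : ∀ᵐ x : ℝ, Tendsto (fun ε : ℝ => F (x - ε * Complex.I)) (𝓝[>] 0) (𝓝 (f₂ x)))
    {z : ℂ} (hz : z ∉ (fun x : ℝ => (x : ℂ)) '' E) :
    2 * Real.pi * Complex.I * F z = ∫ x in E, (f₁ x - f₂ x) / (x - z) := by
  rcases ne_or_eq z.im 0 with h | h
  · exact hF.two_pi_I_mul_eq_integral_of_im_ne_zero hE hp h₁ h₂ h
  -- At a real point of the complement both sides are limits along the vertical line.
  obtain ⟨t, rfl⟩ : ∃ t : ℝ, (t : ℂ) = z := ⟨z.re, Complex.ext (by simp) (by simp [h])⟩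
  have ht : t ∉ E := fun h => hz ⟨t, h, rfl⟩
  obtain ⟨d, hd0, hd⟩ := Metric.mem_nhds_iff.1 (hE.isClosed.isOpen_compl.mem_nhds ht)
  have hdE : ∀ x ∈ E, d ≤ |x - t| := fun x hx => by
    by_contra! hlt
    exact hd (Metric.mem_ball.2 hlt) hx
  have hleft : Tendsto (fun ε : ℝ => 2 * Real.pi * Complex.I * F (t + ε * Complex.I)) (𝓝[>] 0)
      (𝓝 (2 * Real.pi * Complex.I * F t)) := by
    have h3 := hF.tendsto_of_notMem hE ht 1
    simp only [Complex.ofReal_one, one_mul] at h3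
    exact h3.const_mul _
  have hright : Tendsto (fun ε : ℝ => ∫ x in E, (f₁ x - f₂ x) / (x - (t + ε * Complex.I)))
      (𝓝[>] 0) (𝓝 (∫ x in E, (f₁ x - f₂ x) / (x - t))) := by
    have hint := hF.integrableOn_jump hE hp h₁ h₂
    refine tendsto_integral_filter_of_dominated_convergence (fun x => ‖f₁ x - f₂ x‖ / d)
      ?_ ?_ (hint.norm.div_const d) ?_
    · filter_upwards [eventually_mem_nhdsWithin] with ε hε
      refine hint.aestronglyMeasurable.div₀ ?_
      exact (by fun_prop : Continuous fun x : ℝ => (x : ℂ) - (t + ε * Complex.I)).aestronglyMeasurable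
    · refine Eventually.of_forall fun ε => (ae_restrict_iff' hE.measurableSet).2
        (Eventually.of_forall fun x hx => ?_)
      rw [norm_div]
      gcongr
      refine (hdE x hx).trans ?_
      simpa using Complex.abs_re_le_norm ((x : ℂ) - (t + ε * Complex.I))
    · refine (ae_restrict_iff' hE.measurableSet).2 (Eventually.of_forall fun x hx => ?_)
      refine Tendsto.div tendsto_const_nhds ?_ ?_
      · exact (Continuous.tendsto' (by fun_prop) _ _ (by simp)).mono_left nhdsWithin_le_nhds
      · rw [← Complex.ofReal_sub]
        exact_mod_cast abs_pos.1 (hd0.trans_le (hdE x hx))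
  refine tendsto_nhds_unique hleft (hright.congr' ?_)
  filter_upwards [eventually_mem_nhdsWithin] with ε hε
  refine (hF.two_pi_I_mul_eq_integral_of_im_ne_zero hE hp h₁ h₂ ?_).symm
  simpa using ne_of_gt hε

end IsCutHardy

/-! ### Geometry of the cuts and the weighted representation -/

/-- A linear functional on a finite-dimensional space is bounded with respect to any norm, here
given as a seminorm that vanishes only at `0`. -/
theorem exists_norm_le_mul_seminorm {V : Type*} [AddCommGroup V] [Module ℂ V]
    [FiniteDimensional ℂ V] (N : Seminorm ℂ V) (hN : ∀ v, N v = 0 → v = 0) (f : V →ₗ[ℂ] ℂ) :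
    ∃ c : ℝ, 0 ≤ c ∧ ∀ v, ‖f v‖ ≤ c * N v := by
  let : NormedAddCommGroup V := AddGroupNorm.toNormedAddCommGroup
    { N.toAddGroupSeminorm with eq_zero_of_map_eq_zero' := hN }
  let : NormedSpace ℂ V := ⟨fun c v => (map_smul_eq_mul N c v).le⟩
  exact ⟨‖LinearMap.toContinuousLinearMap f‖, norm_nonneg _,
    fun v => (LinearMap.toContinuousLinearMap f).le_opNorm v⟩

theorem eLpNorm_le_of_norm_le_mul {f : ℝ → ℂ} {n : ℝ → ℝ} {c p : ℝ} {M : ENNReal} (hp : 0 < p)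
    (hc : 0 ≤ c) (hn : ∀ x, 0 ≤ n x) (hf : ∀ x, ‖f x‖ ≤ c * n x)
    (hM : ∫⁻ x, ENNReal.ofReal (n x ^ p) ≤ M) :
    eLpNorm f (ENNReal.ofReal p) volume ≤ ENNReal.ofReal c * M ^ (1 / p) := by
  have hp0 : ENNReal.ofReal p ≠ 0 := by simpa using hp
  rw [eLpNorm_eq_lintegral_rpow_enorm_toReal hp0 ENNReal.ofReal_ne_top,
    ENNReal.toReal_ofReal hp.le]
  have h1 : ∫⁻ x, ‖f x‖ₑ ^ p ≤ ENNReal.ofReal c ^ p * M := by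
    calc ∫⁻ x, ‖f x‖ₑ ^ p ≤ ∫⁻ x, ENNReal.ofReal c ^ p * ENNReal.ofReal (n x ^ p) := by
          refine lintegral_mono fun x => ?_
          rw [← ENNReal.ofReal_rpow_of_nonneg (hn x) hp.le, ← ENNReal.mul_rpow_of_nonneg _ _ hp.le,
            ← ENNReal.ofReal_mul hc, ← ofReal_norm]
          gcongr
          exact hf x
      _ = ENNReal.ofReal c ^ p * ∫⁻ x, ENNReal.ofReal (n x ^ p) :=
          lintegral_const_mul' _ _ (by finiteness)
      _ ≤ _ := by gcongr
  refine (ENNReal.rpow_le_rpow h1 (by positivity)).trans_eq ?_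
  rw [ENNReal.mul_rpow_of_nonneg _ _ (by positivity), ← ENNReal.rpow_mul, mul_one_div_cancel hp.ne',
    ENNReal.rpow_one]

namespace RHP

variable {g : ℕ} {a b : ℕ → ℝ}

theorem natAbs_mem_of_mem_idx {j : ℤ} (hj : j ∈ idx g) : 1 ≤ j.natAbs ∧ j.natAbs ≤ g := by
  rw [idx, Finset.mem_erase, Finset.mem_Icc] at hj
  omega

theorem endpoint_le_of_le (hab : ∀ j : ℕ, 1 ≤ j → j ≤ g → a j < b j ∧ b j < a (j + 1)) {m n : ℕ}
    (hm : 1 ≤ m) (hmn : m ≤ n) (hn : n ≤ g + 1) : a m ≤ a n := by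
  induction n, hmn using Nat.le_induction with
  | base => rfl
  | succ n hmn ih =>
    have := hab n (hm.trans hmn) (by omega)
    linarith [ih (by omega)]

theorem closure_cut (hab : ∀ j : ℕ, 1 ≤ j → j ≤ g → a j < b j ∧ b j < a (j + 1)) {j : ℤ}
    (hj : j ∈ idx g) : closure (cut a b j) =
      if 0 < j then Set.Icc (b j.natAbs) (a (j.natAbs + 1))
      else Set.Icc (-a (j.natAbs + 1)) (-b j.natAbs) := by
  obtain ⟨h1, h2⟩ := natAbs_mem_of_mem_idx hj
  have := (hab _ h1 h2).2
  rw [cut]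
  split_ifs
  · exact closure_Ioo this.ne
  · exact closure_Ioo (neg_lt_neg this).ne

theorem mem_closure_cut (ha : a 1 = 0)
    (hab : ∀ j : ℕ, 1 ≤ j → j ≤ g → a j < b j ∧ b j < a (j + 1)) {j : ℤ} (hj : j ∈ idx g) {x : ℝ}
    (hx : x ∈ closure (cut a b j)) :
    (b j.natAbs ≤ |x| ∧ |x| ≤ a (j.natAbs + 1)) ∧ (0 < j ↔ 0 < x) := by
  obtain ⟨h1, h2⟩ := natAbs_mem_of_mem_idx hj
  have h3 := endpoint_le_of_le hab le_rfl h1 (by omega)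
  have h4 := (hab _ h1 h2).1
  rw [closure_cut hab hj] at hx
  split_ifs at hx with h
  · have hx0 : 0 < x := by linarith [hx.1]
    rw [abs_of_pos hx0]
    exact ⟨hx, by simp [h, hx0]⟩
  · have hx0 : x < 0 := by linarith [hx.2]
    rw [abs_of_neg hx0]
    exact ⟨⟨by linarith [hx.2], by linarith [hx.1]⟩, by simp [h, hx0.le]⟩

theorem disjoint_closure_cut (ha : a 1 = 0)
    (hab : ∀ j : ℕ, 1 ≤ j → j ≤ g → a j < b j ∧ b j < a (j + 1)) :
    ((idx g : Finset ℤ) : Set ℤ).Pairwise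
      (Function.onFun Disjoint fun j => closure (cut a b j)) := by
  intro j hj k hk hjk
  refine Set.disjoint_left.2 fun x hxj hxk => hjk ?_
  obtain ⟨⟨hj1, hj2⟩, hj3⟩ := mem_closure_cut ha hab hj hxj
  obtain ⟨⟨hk1, hk2⟩, hk3⟩ := mem_closure_cut ha hab hk hxk
  obtain ⟨j1, jg⟩ := natAbs_mem_of_mem_idx hj
  obtain ⟨k1, kg⟩ := natAbs_mem_of_mem_idx hk
  have key : ∀ m n : ℕ, 1 ≤ m → n ≤ g → b n ≤ |x| → |x| ≤ a (m + 1) → n ≤ m := by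
    intro m n hm hn h1 h2
    by_contra! hmn
    have := endpoint_le_of_le hab (m := m + 1) (by omega) hmn (by omega)
    linarith [(hab n (by omega) hn).1]
  have e1 := key _ _ j1 kg hk1 hj2
  have e2 := key _ _ k1 jg hj1 hk2
  have e3 : 0 < j ↔ 0 < k := hj3.trans hk3.symm
  omega

theorem closure_cut_ae_eq (hab : ∀ j : ℕ, 1 ≤ j → j ≤ g → a j < b j ∧ b j < a (j + 1)) {j : ℤ}
    (hj : j ∈ idx g) : closure (cut a b j) =ᵐ[volume] cut a b j := by
  rw [closure_cut hab hj, cut]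
  split_ifs
  · exact Ioo_ae_eq_Icc.symm
  · exact Ioo_ae_eq_Icc.symm

theorem measurableSet_cut (a b : ℕ → ℝ) (j : ℤ) : MeasurableSet (cut a b j) := by
  rw [cut]
  split_ifs <;> exact measurableSet_Ioo

theorem weight_ne_zero {j : ℤ} {y : ℝ} (hy : y ∈ cut a b j) : weight a b j y ≠ 0 := by
  rw [weight, Set.indicator_of_mem hy]
  rw [cut] at hy
  have hpi := Real.pi_pos
  split_ifs at hy ⊢
  · have : 0 < (y - b j.natAbs) / (a (j.natAbs + 1) - y) :=
      div_pos (by linarith [hy.1]) (by linarith [hy.2])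
    positivity
  · have : 0 < (-b j.natAbs - y) / (y + a (j.natAbs + 1)) :=
      div_pos (by linarith [hy.2]) (by linarith [hy.1])
    positivity

/-- The union of the closed cuts, as a subset of the real line. -/
def realContour (g : ℕ) (a b : ℕ → ℝ) : Set ℝ := ⋃ j ∈ idx g, closure (cut a b j)

theorem contour_eq_image (g : ℕ) (a b : ℕ → ℝ) :
    contour g a b = (fun y : ℝ => (y : ℂ)) '' realContour g a b := by
  simp only [contour, realContour, Set.image_iUnion]

theorem isCompact_realContour (hab : ∀ j : ℕ, 1 ≤ j → j ≤ g → a j < b j ∧ b j < a (j + 1)) :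
    IsCompact (realContour g a b) := by
  refine (idx g).isCompact_biUnion fun j hj => ?_
  rw [closure_cut hab hj]
  split_ifs <;> exact isCompact_Icc

theorem integral_realContour (ha : a 1 = 0)
    (hab : ∀ j : ℕ, 1 ≤ j → j ≤ g → a j < b j ∧ b j < a (j + 1)) {f : ℝ → ℂ}
    (hf : IntegrableOn f (realContour g a b)) :
    ∫ x in realContour g a b, f x = ∑ j ∈ idx g, ∫ x in cut a b j, f x := by
  rw [realContour, integral_biUnion_finset _ (fun j _ => isClosed_closure.measurableSet)
    (disjoint_closure_cut ha hab)
    fun j hj => hf.mono_set (Set.subset_biUnion_of_mem (u := fun j => closure (cut a b j)) hj)]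
  exact Finset.sum_congr rfl fun j hj => setIntegral_congr_set (closure_cut_ae_eq hab hj)

/-- The weight in the density cancels the weight in the Cauchy transform. -/
theorem cauchy_divWeight_apply {m : ℕ} (D : ℝ → Matrix (Fin m) (Fin 2) ℂ) (j : ℤ) (z : ℂ)
    (i : Fin m) (k : Fin 2) :
    cauchy a b j (divWeight a b D j) z i k =
      1 / (2 * (Real.pi : ℂ) * Complex.I) * ∫ y in cut a b j, D y i k / ((y : ℂ) - z) := by
  rw [cauchy, Matrix.of_apply]
  congr 1
  refine setIntegral_congr_fun (measurableSet_cut a b j) fun y hy => ?_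
  have hw : ((weight a b j y : ℝ) : ℂ) ≠ 0 := by exact_mod_cast weight_ne_zero hy
  simp only [divWeight, Matrix.smul_apply, smul_eq_mul]
  push_cast
  field_simp

end RHP

theorem theoremt (g m : ℕ) (a b : ℕ → ℝ) (ha : a 1 = 0)
    (hab : ∀ j : ℕ, 1 ≤ j → j ≤ g → a j < b j ∧ b j < a (j + 1))
    (Ω : ℕ → ℂ) (C : Matrix (Fin m) (Fin 2) ℂ) (S : ℂ → Matrix (Fin m) (Fin 2) ℂ)
    (hS : ∀ (i : Fin m) (k : Fin 2),
      DifferentiableOn ℂ (fun z => S z i k) (RHP.contour g a b)ᶜ)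
    (N : Seminorm ℂ (Matrix (Fin m) (Fin 2) ℂ)) (hN : ∀ A, N A = 0 → A = 0)
    (p : ℝ) (hp1 : 1 < p) (hp2 : p < 2)
    (hplus : (⨆ ρ ∈ Set.Ioi (0 : ℝ), ∫⁻ y : ℝ,
      ENNReal.ofReal (N (S ((y : ℂ) + (ρ : ℂ) * Complex.I) - C) ^ p)) < ⊤)
    (hminus : (⨆ ρ ∈ Set.Ioi (0 : ℝ), ∫⁻ y : ℝ,
      ENNReal.ofReal (N (S ((y : ℂ) - (ρ : ℂ) * Complex.I) - C) ^ p)) < ⊤)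
    (hjump : RHP.JumpCondition g a b Ω S)
    (hL2 : RHP.MemWeightedL2 g a b
      (RHP.divWeight a b fun y => RHP.plusValue S y - RHP.minusValue S y)) :
    RHP.IsSolutionWith g a b Ω C S
      (RHP.divWeight a b fun y => RHP.plusValue S y - RHP.minusValue S y) := by
  have hE := RHP.isCompact_realContour hab
  have hp0 : 0 < p := by linarith
  have hcut : ∀ (i : Fin m) (k : Fin 2), ∃ K : NNReal,
      IsCutHardy p K (RHP.realContour g a b) fun z => S z i k - C i k := by
    intro i k
    obtain ⟨c, hc0, hc⟩ := exists_norm_le_mul_seminorm N hN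
      ((LinearMap.proj k : (Fin 2 → ℂ) →ₗ[ℂ] ℂ) ∘ₗ (LinearMap.proj i :
        (Fin m → Fin 2 → ℂ) →ₗ[ℂ] (Fin 2 → ℂ)))
    obtain ⟨M₁, hM₁⟩ : ∃ M : NNReal, (M : ENNReal) = _ := ⟨_, ENNReal.coe_toNNReal hplus.ne⟩
    obtain ⟨M₂, hM₂⟩ : ∃ M : NNReal, (M : ENNReal) = _ := ⟨_, ENNReal.coe_toNNReal hminus.ne⟩
    have hK : ENNReal.ofReal c * (max M₁ M₂ : NNReal) ^ (1 / p) ≠ ⊤ := by finiteness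
    refine ⟨(ENNReal.ofReal c * (max M₁ M₂ : NNReal) ^ (1 / p)).toNNReal, ?_, ?_, ?_⟩
    · rw [← RHP.contour_eq_image]
      exact (hS i k).sub_const _
    · intro ρ hρ
      rw [ENNReal.coe_toNNReal hK]
      refine eLpNorm_le_of_norm_le_mul hp0 hc0 (fun x => apply_nonneg N _)
        (fun x => hc (S ((x : ℂ) + (ρ : ℂ) * Complex.I) - C)) ?_
      refine (le_iSup₂_of_le (f := fun ρ (_ : ρ ∈ Set.Ioi (0 : ℝ)) => ∫⁻ y : ℝ,
        ENNReal.ofReal (N (S ((y : ℂ) + (ρ : ℂ) * Complex.I) - C) ^ p)) ρ hρ le_rfl).trans ?_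
      rw [← hM₁]
      exact_mod_cast le_max_left M₁ M₂
    · intro ρ hρ
      rw [ENNReal.coe_toNNReal hK]
      refine eLpNorm_le_of_norm_le_mul hp0 hc0 (fun x => apply_nonneg N _)
        (fun x => hc (S ((x : ℂ) - (ρ : ℂ) * Complex.I) - C)) ?_
      refine (le_iSup₂_of_le (f := fun ρ (_ : ρ ∈ Set.Ioi (0 : ℝ)) => ∫⁻ y : ℝ,
        ENNReal.ofReal (N (S ((y : ℂ) - (ρ : ℂ) * Complex.I) - C) ^ p)) ρ hρ le_rfl).trans ?_
      rw [← hM₂]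
      exact_mod_cast le_max_right M₁ M₂
  choose K hK using hcut
  have hplusEx : ∀ᵐ y : ℝ, ∃ A, RHP.HasPlusValue S y A := by
    filter_upwards [ae_all_iff.2 fun i => ae_all_iff.2 fun k => (hK i k).ae_exists_upper hp1]
      with y hy
    choose L hL using hy
    refine ⟨fun i k => L i k + C i k, tendsto_pi_nhds.2 fun i => tendsto_pi_nhds.2 fun k => ?_⟩
    simpa using (hL i k).add_const (C i k)
  have hminusEx : ∀ᵐ y : ℝ, ∃ A, RHP.HasMinusValue S y A := by
    filter_upwards [ae_all_iff.2 fun i => ae_all_iff.2 fun k => (hK i k).ae_exists_lower hE hp1]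
      with y hy
    choose L hL using hy
    refine ⟨fun i k => L i k + C i k, tendsto_pi_nhds.2 fun i => tendsto_pi_nhds.2 fun k => ?_⟩
    simpa using (hL i k).add_const (C i k)
  -- Since the limits exist almost everywhere, `plusValue` and `minusValue` are limits there and not
  -- the junk values of `limUnder`.
  have hplusLim : ∀ᵐ y : ℝ, RHP.HasPlusValue S y (RHP.plusValue S y) :=
    hplusEx.mono fun y hy => tendsto_nhds_limUnder hy
  have hminusLim : ∀ᵐ y : ℝ, RHP.HasMinusValue S y (RHP.minusValue S y) :=
    hminusEx.mono fun y hy => tendsto_nhds_limUnder hy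
  refine ⟨hL2, fun z hz => ?_, fun j _ => ae_restrict_of_ae (hplusEx.and hminusEx), hjump⟩
  ext i k
  have h₁ : ∀ᵐ y : ℝ, Tendsto (fun ε : ℝ => S (y + ε * Complex.I) i k - C i k) (𝓝[>] 0)
      (𝓝 (RHP.plusValue S y i k - C i k)) := hplusLim.mono fun y hy =>
    (tendsto_pi_nhds.1 (tendsto_pi_nhds.1 hy i) k).sub_const _
  have h₂ : ∀ᵐ y : ℝ, Tendsto (fun ε : ℝ => S (y - ε * Complex.I) i k - C i k) (𝓝[>] 0)
      (𝓝 (RHP.minusValue S y i k - C i k)) := hminusLim.mono fun y hy =>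
    (tendsto_pi_nhds.1 (tendsto_pi_nhds.1 hy i) k).sub_const _
  rw [RHP.contour_eq_image] at hz
  have hrep := (hK i k).two_pi_I_mul_eq_integral hE hp1 h₁ h₂ hz
  have hint := (hK i k).integrableOn_div_sub hE hp1 h₁ h₂ hz
  rw [RHP.integral_realContour ha hab hint] at hrep
  rw [Matrix.add_apply, Matrix.sum_apply]
  simp only [RHP.cauchy_divWeight_apply, Matrix.sub_apply, sub_sub_sub_cancel_right] at hrep ⊢
  rw [← Finset.mul_sum, ← hrep]
  have hpi : (2 * (Real.pi : ℂ) * Complex.I) ≠ 0 := by simp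
  rw [one_div, inv_mul_cancel_left₀ hpi]
  ring
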